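/- Let $G$ be a finite group. **Coefficient systems.** A *coefficient system* $\underline{\mathcal C}$ assigns to every subgroup $H\le G$ a class $\underline{\mathcal C}(H)$ of finite $H$-sets that contains all finite $H$-sets with trivial action and is closed under isomorphism, such that $T\in\underline{\mathcal C}(H)$ implies $\mathrm{res}^H_K T\in\underline{\mathcal C}(K)$ for all $K\le H$ and $aT\in\underline{\mathcal C}(aHa^{-1})$ for all $a\in G$. It is an *indexing system* if moreover every $\underline{\mathcal C}(H)$ is closed under subobjects and finite coproducts, and for all $K\le H\le G$, $T\in\underline{\mathcal C}(K)$ and $H/K\in\underline{\mathcal C}(H)$ imply $H\times_K T\in\underline{\mathcal C}(H)$. **Admissible sets.** A symmetric sequence $S_\bullet$ of (possibly infinite) $G$-sets consists of a $(G\times\Sigma_n)$-set $S_n$ for every $n\ge 0$. It lies in $N\mathbf{Sym}$ if every $\Sigma_n$ acts freely on $S_n$ and $S_n^{H\times\{e\}}\neq\varnothing$ for all $n\ge0$ and $H\le G$. A finite $H$-set $T$ is *admissible* for $S_\bullet$ if, for some bijection $T\cong\{1,\dots,n\}$ with associated permutation representation $\alpha:H\to\Sigma_n$, the subgroup $\Lambda=\{(h,\alpha(h))\mid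 h\in H\}$ satisfies $S_n^\Lambda\ne\varnothing$. Write $\mathbb A(S)$ for the classes of admissible sets. The admissible sets of an operad in $G$-sets are those of its underlying symmetric sequence; those of an operad in $G$-categories or $G$-spaces are those of its object sets or underlying sets. An operad *realizes* $\underline{\mathcal C}$ if its admissible sets are exactly those of $\underline{\mathcal C}$. **Operads.** $N\mathbf{Op}$ is the category of operads in $G$-sets whose underlying symmetric sequence lies in $N\mathbf{Sym}$, and $\mathbb F(S)$ is the free operad in $G$-sets on $S_\bullet$. An operad $\mathcal O$ in $G$-categories or in $G$-spaces is an *$N_\infty$ operad* if $\Sigma_n$ acts freely on $\mathcal O(n)$, $\mathcal O(n)^{H\times\{e\}}\ne\varnothing$ for all $n\ge 0$ and $H\le G$, and $\mathcal O(n)^\Lambda$ is empty or contractible for every subgroup $\Lambda\le G\times\Sigma_n$; a category is contractible if its classifying space is. For an operad $\mathcal O$ in $G$-sets, $\widetilde{\mathcal O}$ is the operad in $G$-categories obtained by replacing each $\mathcal O(n)$ with the chaotic category on it (one morphism between any two objects). **Theorem.** Let $\underline{\mathcal C}$ be a coefficient system and let $S_\bullet\in N\mathbf{Sym}$ satisfy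 $\mathbb A(S)=\underline{\mathcal C}$. Then $\mathbb F(S)\in N\mathbf{Op}$, and the following are equivalent: 1. (a) $\underline{\mathcal C}$ is realized by an $N_\infty$ operad in $G$-categories; (b) $\underline{\mathcal C}$ is realized by an $N_\infty$ operad in $G$-spaces; (c) $\underline{\mathcal C}$ is realized by an $N_\infty$ operad in compactly generated weak Hausdorff $G$-spaces (with the compactly generated product); 2. $\underline{\mathcal C}$ is realized by an operad in $N\mathbf{Op}$; 3. $\mathbb A(\mathbb F(S))=\underline{\mathcal C}$; 4. $\underline{\mathcal C}$ is an indexing system. Moreover, if $\underline{\mathcal C}$ is an indexing system, then $\widetilde{\mathbb F(S)}$ is an $N_\infty$ operad in $G$-categories that realizes $\underline{\mathcal C}$. Consequently, every indexing system is realized by an $N_\infty$ operad in $G$-categories, by one in $G$-spaces, and by one in compactly generated weak Hausdorff $G$-spaces. -/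

import Mathlib

open Equiv CategoryTheory

universe u

section CoefficientSystems

/-- For an `H`-set `T` and `K ≤ H`, the restricted `K`-set `res T`. -/
abbrev resAction {G : Type u} [Group G] {K H : Subgroup G} (h : K ≤ H) (T : Type u)
    [MulAction H T] : MulAction K T :=
  MulAction.compHom T (Subgroup.inclusion h)

/-- The conjugate subgroup `a H a⁻¹`. -/
def conjSubgroup {G : Type u} [Group G] (a : G) (H : Subgroup G) : Subgroup G :=
  H.map (MulAut.conj a).toMonoidHom

/-- The homomorphism `a H a⁻¹ → H`, `x ↦ a⁻¹ x a`. -/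
def conjHom {G : Type u} [Group G] (a : G) (H : Subgroup G) : conjSubgroup a H →* H where
  toFun x := ⟨a⁻¹ * x.1 * a, by
    obtain ⟨x, y, hy, rfl⟩ := x
    have : a⁻¹ * ((MulAut.conj a).toMonoidHom y) * a = y := by
      simp [mul_assoc]
    rw [this]
    exact hy⟩
  map_one' := by ext; simp
  map_mul' x y := by ext; simp [mul_assoc]

/-- For an `H`-set `T` and `a : G`, the conjugate `a H a⁻¹`-set `a T`: it has the same elements,
and `a h a⁻¹` acts as `h` did. -/
abbrev conjAction {G : Type u} [Group G] (a : G) {H : Subgroup G} (T : Type u) [MulAction H T] :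
    MulAction (conjSubgroup a H) T :=
  MulAction.compHom T (conjHom a H)

/-- A coefficient system: for every subgroup `H` of `G` a class of finite `H`-sets that contains
the finite trivial `H`-sets and is closed under isomorphism, restriction and conjugation. -/
structure CoefSystem (G : Type u) [Group G] where
  /-- `mem H T` says that the `H`-set `T` belongs to the class at `H`. -/
  mem : ∀ (H : Subgroup G) (T : Type u) [MulAction H T], Prop
  finite : ∀ (H : Subgroup G) (T : Type u) [MulAction H T], mem H T → Finite T
  trivial : ∀ (H : Subgroup G) (T : Type u) [MulAction H T] [Finite T],
    (∀ (h : H) (t : T), h • t = t) → mem H T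
  iso : ∀ (H : Subgroup G) (T T' : Type u) [MulAction H T] [MulAction H T'] (e : T ≃ T'),
    (∀ (h : H) (t : T), e (h • t) = h • e t) → mem H T → mem H T'
  res : ∀ (K H : Subgroup G) (h : K ≤ H) (T : Type u) [MulAction H T],
    mem H T → @mem K T (resAction h T)
  conj : ∀ (H : Subgroup G) (a : G) (T : Type u) [MulAction H T],
    mem H T → @mem (conjSubgroup a H) T (conjAction a T)

/-- The equivalence relation on `H × T` generated by `(h k, t) ∼ (h, k t)` for `k ∈ K`. -/
def indSetoid {G : Type u} [Group G] {K H : Subgroup G} (hK : K ≤ H) (T : Type u)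
    [MulAction K T] : Setoid (H × T) where
  r p q := ∃ k : K, p.1 = q.1 * Subgroup.inclusion hK k ∧ q.2 = k • p.2
  iseqv :=
    { refl := fun p => ⟨1, by simp⟩
      symm := by
        rintro p q ⟨k, h1, h2⟩
        exact ⟨k⁻¹, by simp [h1], by simp [h2]⟩
      trans := by
        rintro p q r ⟨k, h1, h2⟩ ⟨l, h3, h4⟩
        exact ⟨l * k, by simp [h1, h3, mul_assoc], by simp [h4, h2, mul_smul]⟩ }

/-- The induced `H`-set `H ×_K T` of a `K`-set `T`. -/
def Ind {G : Type u} [Group G] {K H : Subgroup G} (hK : K ≤ H) (T : Type u)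
    [MulAction K T] : Type u :=
  Quotient (indSetoid hK T)

instance {G : Type u} [Group G] {K H : Subgroup G} (hK : K ≤ H) (T : Type u)
    [MulAction K T] : MulAction H (Ind hK T) where
  smul h := Quotient.map (fun p => (h * p.1, p.2)) (by
    rintro p q ⟨k, h1, h2⟩
    exact ⟨k, by simp [h1, mul_assoc], h2⟩)
  one_smul x := by
    induction x using Quotient.inductionOn with
    | h p =>
      change Quotient.mk _ (1 * p.1, p.2) = Quotient.mk _ p
      simp
  mul_smul g h x := by
    induction x using Quotient.inductionOn with
    | h p =>
      change Quotient.mk _ (g * h * p.1, p.2) = Quotient.mk _ (g * (h * p.1), p.2)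
      simp [mul_assoc]

/-- An indexing system: a coefficient system closed under subobjects, finite coproducts (the empty
one is a trivial `H`-set) and self-induction. -/
structure CoefSystem.IsIndexing {G : Type u} [Group G] (C : CoefSystem G) : Prop where
  sub : ∀ (H : Subgroup G) (T T' : Type u) [MulAction H T] [MulAction H T'] (i : T → T'),
    Function.Injective i → (∀ (h : H) (t : T), i (h • t) = h • i t) → C.mem H T' → C.mem H T
  coprod : ∀ (H : Subgroup G) (T T' : Type u) [MulAction H T] [MulAction H T'],
    C.mem H T → C.mem H T' → C.mem H (T ⊕ T')
  ind : ∀ (K H : Subgroup G) (hK : K ≤ H) (T : Type u) [MulAction K T],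
    C.mem K T → C.mem H (H ⧸ K.subgroupOf H) → C.mem H (Ind hK T)

end CoefficientSystems

section SymmetricSequences

/-- A symmetric sequence of `G`-sets: a `G × Σₙ`-set for every `n`. -/
structure GSymSeq (G : Type u) [Group G] where
  obj : ℕ → Type u
  action : ∀ n, MulAction (G × Perm (Fin n)) (obj n)

attribute [instance] GSymSeq.action

/-- Maps of symmetric sequences of `G`-sets. -/
@[ext]
structure GSymSeq.Hom {G : Type u} [Group G] (X Y : GSymSeq G) where
  app : ∀ n, X.obj n → Y.obj n
  map_smul : ∀ n (a : G × Perm (Fin n)) (x : X.obj n), app n (a • x) = a • app n x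

/-- Membership in `NSym`: every `Σₙ` acts freely, and every subgroup `H × {e}` has a fixed point. -/
structure GSymSeq.IsNSym {G : Type u} [Group G] (X : GSymSeq G) : Prop where
  free : ∀ n (σ : Perm (Fin n)) (x : X.obj n), ((1, σ) : G × Perm (Fin n)) • x = x → σ = 1
  fixed : ∀ n (H : Subgroup G),
    (MulAction.fixedPoints (H.prod (⊥ : Subgroup (Perm (Fin n)))) (X.obj n)).Nonempty

/-- The graph subgroup `{(h, α h) | h ∈ H}` of `G × Σₙ`. -/
def graphSubgroup {G : Type u} [Group G] (H : Subgroup G) {n : ℕ} (α : H →* Perm (Fin n)) :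
    Subgroup (G × Perm (Fin n)) :=
  (H.subtype.prod α).range

/-- The `H`-set `T` is admissible for `X`: for some numbering `T ≃ {1, …, n}` with permutation
representation `α : H → Σₙ`, the graph subgroup of `α` has a fixed point in `Xₙ`. -/
def GSymSeq.Admissible {G : Type u} [Group G] (X : GSymSeq G) (H : Subgroup G) (T : Type u)
    [MulAction H T] : Prop :=
  ∃ (n : ℕ) (e : T ≃ Fin n),
    (MulAction.fixedPoints
      (graphSubgroup H (e.permCongrHom.toMonoidHom.comp (MulAction.toPermHom H T)))
      (X.obj n)).Nonempty

/-- `𝔸(X) = C`: the admissible sets of `X` are precisely the members of `C`. -/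
def GSymSeq.Realizes {G : Type u} [Group G] (X : GSymSeq G) (C : CoefSystem G) : Prop :=
  ∀ (H : Subgroup G) (T : Type u) [MulAction H T], X.Admissible H T ↔ C.mem H T

end SymmetricSequences

section Operads

/-- The lexicographic numbering of the pairs `(i, m)` with `i < k` and `m < jᵢ`, in total arity
`n = j₁ + ⋯ + jₖ`. -/
def leafEquiv {k : ℕ} {j : Fin k → ℕ} {n : ℕ} (h : ∑ i, j i = n) :
    (Σ i, Fin (j i)) ≃ Fin n :=
  finSigmaFinEquiv.trans (finCongr h)

/-- The permutation of `{1, …, n}` that moves blocks as `σ` does: it sends the `m`-th place of the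
`i`-th block of the partition `j (σ 1) + ⋯ + j (σ k) = n` to the `m`-th place of the `σ i`-th block
of the partition `j 1 + ⋯ + j k = n`. -/
def blockPerm {k : ℕ} {j : Fin k → ℕ} {n : ℕ} (σ : Perm (Fin k)) (h : ∑ i, j i = n)
    (h' : ∑ i, j (σ i) = n) : Perm (Fin n) :=
  (leafEquiv h').symm.trans
    ((Equiv.sigmaCongrLeft (β := fun i => Fin (j i)) σ).trans (leafEquiv h))

/-- The block sum `τ₁ ⊕ ⋯ ⊕ τₖ`. -/
def blockSum {k : ℕ} {j : Fin k → ℕ} {n : ℕ} (τ : ∀ i, Perm (Fin (j i))) (h : ∑ i, j i = n) :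
    Perm (Fin n) :=
  (leafEquiv h).symm.trans ((Equiv.sigmaCongrRight τ).trans (leafEquiv h))

/-- An operad in `G`-sets: a symmetric sequence of `G`-sets with a unit and with compositions
`γ(x; y₁, …, yₖ)` of arity `j₁ + ⋯ + jₖ`. To avoid casts, `comp h x y` takes the total arity `n` and
a proof `h` that it is the sum of the `jᵢ`. The symmetric groups act from the left: `σ x` has as
its input `σ i` the input `i` of `x`. -/
structure GOperad (G : Type u) [Group G] extends GSymSeq G where
  one : obj 1
  comp : ∀ {k : ℕ} {j : Fin k → ℕ} {n : ℕ}, ∑ i, j i = n → obj k → (∀ i, obj (j i)) → obj n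
  one_comp : ∀ {n : ℕ} (h : ∑ _ : Fin 1, n = n) (x : obj n), comp h one (fun _ => x) = x
  comp_one : ∀ {n : ℕ} (h : ∑ _ : Fin n, 1 = n) (x : obj n), comp h x (fun _ => one) = x
  assoc : ∀ {k : ℕ} {j : Fin k → ℕ} {m : ℕ} {l : (Σ i, Fin (j i)) → ℕ} {q : Fin k → ℕ} {n : ℕ}
    (h : ∑ i, j i = m) (h' : ∑ p : Fin m, l ((leafEquiv h).symm p) = n)
    (hq : ∀ i, ∑ b, l ⟨i, b⟩ = q i) (h'' : ∑ i, q i = n)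
    (x : obj k) (y : ∀ i, obj (j i)) (z : ∀ s, obj (l s)),
    comp h' (comp h x y) (fun p => z ((leafEquiv h).symm p)) =
      comp h'' x (fun i => comp (hq i) (y i) (fun b => z ⟨i, b⟩))
  perm_comp : ∀ {k : ℕ} {j : Fin k → ℕ} {n : ℕ} (σ : Perm (Fin k)) (h : ∑ i, j i = n)
    (h' : ∑ i, j (σ i) = n) (x : obj k) (y : ∀ i, obj (j i)),
    comp h (((1, σ) : G × Perm (Fin k)) • x) y =
      ((1, blockPerm σ h h') : G × Perm (Fin n)) • comp h' x (fun i => y (σ i))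
  comp_perm : ∀ {k : ℕ} {j : Fin k → ℕ} {n : ℕ} (τ : ∀ i, Perm (Fin (j i))) (h : ∑ i, j i = n)
    (x : obj k) (y : ∀ i, obj (j i)),
    comp h x (fun i => ((1, τ i) : G × Perm (Fin (j i))) • y i) =
      ((1, blockSum τ h) : G × Perm (Fin n)) • comp h x y
  smul_one : ∀ g : G, ((g, 1) : G × Perm (Fin 1)) • one = one
  smul_comp : ∀ {k : ℕ} {j : Fin k → ℕ} {n : ℕ} (g : G) (h : ∑ i, j i = n)
    (x : obj k) (y : ∀ i, obj (j i)),
    comp h (((g, 1) : G × Perm (Fin k)) • x) (fun i => ((g, 1) : G × Perm (Fin (j i))) • y i) =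
      ((g, 1) : G × Perm (Fin n)) • comp h x y

/-- Maps of operads in `G`-sets. -/
@[ext]
structure GOperad.Hom {G : Type u} [Group G] (O P : GOperad G)
    extends GSymSeq.Hom O.toGSymSeq P.toGSymSeq where
  map_one : app 1 O.one = P.one
  map_comp : ∀ {k : ℕ} {j : Fin k → ℕ} {n : ℕ} (h : ∑ i, j i = n) (x : O.obj k)
    (y : ∀ i, O.obj (j i)),
    app n (O.comp h x y) = P.comp h (app k x) (fun i => app (j i) (y i))

end Operads

section FreeOperad

/-- Formal operadic expressions in the elements of a symmetric sequence `S`. -/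
inductive FreeTerm {G : Type u} [Group G] (S : GSymSeq G) : ℕ → Type u
  | gen {n : ℕ} (s : S.obj n) : FreeTerm S n
  | one : FreeTerm S 1
  | act {n : ℕ} (a : G × Perm (Fin n)) (t : FreeTerm S n) : FreeTerm S n
  | comp {k : ℕ} {j : Fin k → ℕ} {n : ℕ} (h : ∑ i, j i = n) (t : FreeTerm S k)
      (v : ∀ i, FreeTerm S (j i)) : FreeTerm S n

/-- The smallest congruence on formal expressions that forces the laws of an operad in `G`-sets and
the equivariance of the inclusion of `S`. -/
inductive FreeRel {G : Type u} [Group G] (S : GSymSeq G) :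
    ∀ {n : ℕ}, FreeTerm S n → FreeTerm S n → Prop
  | refl {n : ℕ} (t : FreeTerm S n) : FreeRel S t t
  | symm {n : ℕ} {t t' : FreeTerm S n} : FreeRel S t t' → FreeRel S t' t
  | trans {n : ℕ} {t t' t'' : FreeTerm S n} : FreeRel S t t' → FreeRel S t' t'' → FreeRel S t t''
  | congr_act {n : ℕ} (a : G × Perm (Fin n)) {t t' : FreeTerm S n} :
      FreeRel S t t' → FreeRel S (.act a t) (.act a t')
  | congr_comp {k : ℕ} {j : Fin k → ℕ} {n : ℕ} (h : ∑ i, j i = n) {t t' : FreeTerm S k}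
      {v v' : ∀ i, FreeTerm S (j i)} : FreeRel S t t' → (∀ i, FreeRel S (v i) (v' i)) →
      FreeRel S (.comp h t v) (.comp h t' v')
  | act_gen {n : ℕ} (a : G × Perm (Fin n)) (s : S.obj n) :
      FreeRel S (.act a (.gen s)) (.gen (a • s))
  | one_act {n : ℕ} (t : FreeTerm S n) : FreeRel S (.act 1 t) t
  | mul_act {n : ℕ} (a b : G × Perm (Fin n)) (t : FreeTerm S n) :
      FreeRel S (.act (a * b) t) (.act a (.act b t))
  | one_comp {n : ℕ} (h : ∑ _ : Fin 1, n = n) (t : FreeTerm S n) :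
      FreeRel S (.comp h .one (fun _ => t)) t
  | comp_one {n : ℕ} (h : ∑ _ : Fin n, 1 = n) (t : FreeTerm S n) :
      FreeRel S (.comp h t (fun _ => .one)) t
  | assoc {k : ℕ} {j : Fin k → ℕ} {m : ℕ} {l : (Σ i, Fin (j i)) → ℕ} {q : Fin k → ℕ} {n : ℕ}
      (h : ∑ i, j i = m) (h' : ∑ p : Fin m, l ((leafEquiv h).symm p) = n)
      (hq : ∀ i, ∑ b, l ⟨i, b⟩ = q i) (h'' : ∑ i, q i = n)
      (t : FreeTerm S k) (v : ∀ i, FreeTerm S (j i)) (w : ∀ s, FreeTerm S (l s)) :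
      FreeRel S (.comp h' (.comp h t v) (fun p => w ((leafEquiv h).symm p)))
        (.comp h'' t (fun i => .comp (hq i) (v i) (fun b => w ⟨i, b⟩)))
  | perm_comp {k : ℕ} {j : Fin k → ℕ} {n : ℕ} (σ : Perm (Fin k)) (h : ∑ i, j i = n)
      (h' : ∑ i, j (σ i) = n) (t : FreeTerm S k) (v : ∀ i, FreeTerm S (j i)) :
      FreeRel S (.comp h (.act (1, σ) t) v)
        (.act (1, blockPerm σ h h') (.comp h' t (fun i => v (σ i))))
  | comp_perm {k : ℕ} {j : Fin k → ℕ} {n : ℕ} (τ : ∀ i, Perm (Fin (j i))) (h : ∑ i, j i = n)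
      (t : FreeTerm S k) (v : ∀ i, FreeTerm S (j i)) :
      FreeRel S (.comp h t (fun i => .act (1, τ i) (v i)))
        (.act (1, blockSum τ h) (.comp h t v))
  | smul_one (g : G) : FreeRel S (.act (g, 1) .one) .one
  | smul_comp {k : ℕ} {j : Fin k → ℕ} {n : ℕ} (g : G) (h : ∑ i, j i = n)
      (t : FreeTerm S k) (v : ∀ i, FreeTerm S (j i)) :
      FreeRel S (.comp h (.act (g, 1) t) (fun i => .act (g, 1) (v i)))
        (.act (g, 1) (.comp h t v))

/-- Formal expressions up to the congruence. -/
def freeSetoid {G : Type u} [Group G] (S : GSymSeq G) (n : ℕ) : Setoid (FreeTerm S n) where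
  r := FreeRel S
  iseqv := ⟨FreeRel.refl, FreeRel.symm, FreeRel.trans⟩

/-- The symmetric sequence underlying the free operad. -/
def freeSymSeq {G : Type u} [Group G] (S : GSymSeq G) : GSymSeq G where
  obj n := Quotient (freeSetoid S n)
  action n :=
    { smul := fun a => Quotient.map (FreeTerm.act a) (fun _ _ h => FreeRel.congr_act a h)
      one_smul := fun x => by
        induction x using Quotient.inductionOn with
        | h t => exact Quotient.sound (FreeRel.one_act t)
      mul_smul := fun a b x => by
        induction x using Quotient.inductionOn with
        | h t => exact Quotient.sound (FreeRel.mul_act a b t) }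

/-- The class of a formal expression. -/
def freeMk {G : Type u} [Group G] {S : GSymSeq G} {n : ℕ} (t : FreeTerm S n) :
    (freeSymSeq S).obj n :=
  Quotient.mk (freeSetoid S n) t

theorem freeMk_surjective {G : Type u} [Group G] {S : GSymSeq G} {n : ℕ} :
    Function.Surjective (freeMk : FreeTerm S n → (freeSymSeq S).obj n) :=
  Quotient.mk_surjective

theorem freeMk_eq {G : Type u} [Group G] {S : GSymSeq G} {n : ℕ} {t t' : FreeTerm S n} :
    freeMk t = freeMk t' ↔ FreeRel S t t' :=
  ⟨fun h => Quotient.exact h, fun h => Quotient.sound h⟩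

theorem smul_freeMk {G : Type u} [Group G] {S : GSymSeq G} {n : ℕ} (a : G × Perm (Fin n))
    (t : FreeTerm S n) : a • freeMk t = freeMk (.act a t) := rfl

/-- Composition of classes of formal expressions. -/
noncomputable def freeComp {G : Type u} [Group G] {S : GSymSeq G} {k : ℕ} {j : Fin k → ℕ} {n : ℕ}
    (h : ∑ i, j i = n) (x : (freeSymSeq S).obj k) (y : ∀ i, (freeSymSeq S).obj (j i)) :
    (freeSymSeq S).obj n :=
  freeMk (.comp h (Quotient.out x) (fun i => Quotient.out (y i)))

theorem freeComp_freeMk {G : Type u} [Group G] {S : GSymSeq G} {k : ℕ} {j : Fin k → ℕ} {n : ℕ}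
    (h : ∑ i, j i = n) (t : FreeTerm S k) (v : ∀ i, FreeTerm S (j i)) :
    freeComp h (freeMk t) (fun i => freeMk (v i)) = freeMk (.comp h t v) :=
  Quotient.sound (FreeRel.congr_comp h (Quotient.exact (Quotient.out_eq (freeMk t)))
    (fun i => Quotient.exact (Quotient.out_eq (freeMk (v i)))))

theorem exists_freeMk {G : Type u} [Group G] {S : GSymSeq G} {ι : Type*} {j : ι → ℕ}
    (y : ∀ i, (freeSymSeq S).obj (j i)) :
    ∃ v : ∀ i, FreeTerm S (j i), y = fun i => freeMk (v i) := by
  choose v hv using fun i => freeMk_surjective (y i)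
  exact ⟨v, funext fun i => (hv i).symm⟩

/-- The free operad `𝔽(S)` in `G`-sets on a symmetric sequence `S`, by generators and relations. -/
noncomputable def freeOperad {G : Type u} [Group G] (S : GSymSeq G) : GOperad G where
  toGSymSeq := freeSymSeq S
  one := freeMk .one
  comp := freeComp
  one_comp h x := by
    obtain ⟨t, rfl⟩ := freeMk_surjective x
    rw [freeComp_freeMk h .one (fun _ => t), freeMk_eq]
    exact .one_comp h t
  comp_one h x := by
    obtain ⟨t, rfl⟩ := freeMk_surjective x
    rw [freeComp_freeMk h t (fun _ => .one), freeMk_eq]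
    exact .comp_one h t
  assoc h h' hq h'' x y z := by
    obtain ⟨t, rfl⟩ := freeMk_surjective x
    obtain ⟨v, rfl⟩ := exists_freeMk y
    obtain ⟨w, rfl⟩ := exists_freeMk z
    simp only [freeComp_freeMk]
    rw [freeMk_eq]
    exact .assoc h h' hq h'' t v w
  perm_comp σ h h' x y := by
    obtain ⟨t, rfl⟩ := freeMk_surjective x
    obtain ⟨v, rfl⟩ := exists_freeMk y
    rw [smul_freeMk, freeComp_freeMk, freeComp_freeMk h' t (fun i => v (σ i)), smul_freeMk,
      freeMk_eq]
    exact .perm_comp σ h h' t v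
  comp_perm τ h x y := by
    obtain ⟨t, rfl⟩ := freeMk_surjective x
    obtain ⟨v, rfl⟩ := exists_freeMk y
    simp only [smul_freeMk]
    rw [freeComp_freeMk, freeComp_freeMk, smul_freeMk, freeMk_eq]
    exact .comp_perm τ h t v
  smul_one g := by
    rw [smul_freeMk, freeMk_eq]
    exact .smul_one g
  smul_comp g h x y := by
    obtain ⟨t, rfl⟩ := freeMk_surjective x
    obtain ⟨v, rfl⟩ := exists_freeMk y
    simp only [smul_freeMk]
    rw [freeComp_freeMk, freeComp_freeMk, smul_freeMk, freeMk_eq]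
    exact .smul_comp g h t v

/-- The unit `η : S → 𝔽(S)`. -/
noncomputable def freeUnit {G : Type u} [Group G] (S : GSymSeq G) :
    GSymSeq.Hom S (freeOperad S).toGSymSeq where
  app _ s := freeMk (.gen s)
  map_smul _ a s := by
    symm
    exact freeMk_eq.2 (.act_gen a s)

/-- Evaluation of formal expressions in an operad. -/
def freeEval {G : Type u} [Group G] {S : GSymSeq G} (O : GOperad G)
    (f : GSymSeq.Hom S O.toGSymSeq) : ∀ {n : ℕ}, FreeTerm S n → O.obj n
  | _, .gen s => f.app _ s
  | _, .one => O.one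
  | _, .act a t => a • freeEval O f t
  | _, .comp h t v => O.comp h (freeEval O f t) (fun i => freeEval O f (v i))

theorem freeEval_eq {G : Type u} [Group G] {S : GSymSeq G} (O : GOperad G)
    (f : GSymSeq.Hom S O.toGSymSeq) {n : ℕ} {t t' : FreeTerm S n} (h : FreeRel S t t') :
    freeEval O f t = freeEval O f t' := by
  induction h with
  | refl t => rfl
  | symm _ ih => exact ih.symm
  | trans _ _ ih ih' => exact ih.trans ih'
  | congr_act a _ ih => simp only [freeEval, ih]
  | congr_comp h _ _ ih ih' => simp only [freeEval, ih, ih']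
  | act_gen a s => simp only [freeEval, f.map_smul]
  | one_act t => simp only [freeEval, one_smul]
  | mul_act a b t => simp only [freeEval, mul_smul]
  | one_comp h t => exact O.one_comp h _
  | comp_one h t => exact O.comp_one h _
  | assoc h h' hq h'' t v w =>
    exact O.assoc h h' hq h'' (freeEval O f t) (fun i => freeEval O f (v i))
      (fun s => freeEval O f (w s))
  | perm_comp σ h h' t v => exact O.perm_comp σ h h' _ (fun i => freeEval O f (v i))
  | comp_perm τ h t v => exact O.comp_perm τ h _ (fun i => freeEval O f (v i))
  | smul_one g => exact O.smul_one g
  | smul_comp g h t v => exact O.smul_comp g h _ (fun i => freeEval O f (v i))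

/-- The universal property of the free operad. -/
theorem freeOperad_universal {G : Type u} [Group G] (S : GSymSeq G) (O : GOperad G)
    (f : GSymSeq.Hom S O.toGSymSeq) :
    ∃! F : GOperad.Hom (freeOperad S) O,
      ∀ n (s : S.obj n), F.app n ((freeUnit S).app n s) = f.app n s := by
  refine ⟨{ app := fun n => Quotient.lift (freeEval O f) (fun _ _ h => freeEval_eq O f h)
            map_smul := ?_, map_one := rfl, map_comp := ?_ }, fun _ _ => rfl, ?_⟩
  · intro n a x
    obtain ⟨t, rfl⟩ := freeMk_surjective x
    rfl
  · intro k j n h x y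
    obtain ⟨t, rfl⟩ := freeMk_surjective x
    obtain ⟨v, rfl⟩ := exists_freeMk y
    change Quotient.lift _ _ (freeComp h _ _) = _
    rw [freeComp_freeMk]
    rfl
  · intro F hF
    have key : ∀ {n : ℕ} (t : FreeTerm S n), F.app n (freeMk t) = freeEval O f t := by
      intro n t
      induction t with
      | gen s => exact hF _ s
      | one => exact F.map_one
      | act a t ih => exact (F.map_smul _ a (freeMk t)).trans (by rw [ih]; rfl)
      | comp h t v ih ih' =>
        rw [← freeComp_freeMk]
        exact (F.map_comp h (freeMk t) (fun i => freeMk (v i))).trans (by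
          simp only [ih, ih']; rfl)
    apply GOperad.Hom.ext
    funext n x
    obtain ⟨t, rfl⟩ := freeMk_surjective x
    exact key t

end FreeOperad

section CategoricalOperads

/-- An operad in `G`-categories. Its objects form an operad `ob` in `G`-sets, each `ob.obj n` is the
set of objects of a small category, and the actions of the elements of `G × Σₙ` and the
compositions are functors: `actMap` and `compMap` are their effect on morphisms. The laws of an
operad hold for these functors. On objects this is the operad `ob`, on morphisms the two sides of
a law have sources (and targets) that are equal but not by definition, hence `HEq`. The unit,
a functor from the terminal category, is an object together with its identity morphism. -/
structure GCatOperad (G : Type u) [Group G] where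
  ob : GOperad G
  cat : ∀ n, SmallCategory (ob.obj n)
  actMap : ∀ {n : ℕ} (a : G × Perm (Fin n)) {x x' : ob.obj n}, (x ⟶ x') → (a • x ⟶ a • x')
  actMap_id : ∀ {n : ℕ} (a : G × Perm (Fin n)) (x : ob.obj n), actMap a (𝟙 x) = 𝟙 (a • x)
  actMap_comp : ∀ {n : ℕ} (a : G × Perm (Fin n)) {x x' x'' : ob.obj n} (f : x ⟶ x')
    (f' : x' ⟶ x''), actMap a (f ≫ f') = actMap a f ≫ actMap a f'
  compMap : ∀ {k : ℕ} {j : Fin k → ℕ} {n : ℕ} (h : ∑ i, j i = n) {x x' : ob.obj k}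
    {y y' : ∀ i, ob.obj (j i)}, (x ⟶ x') → (∀ i, y i ⟶ y' i) →
    (ob.comp h x y ⟶ ob.comp h x' y')
  compMap_id : ∀ {k : ℕ} {j : Fin k → ℕ} {n : ℕ} (h : ∑ i, j i = n) (x : ob.obj k)
    (y : ∀ i, ob.obj (j i)), compMap h (𝟙 x) (fun i => 𝟙 (y i)) = 𝟙 (ob.comp h x y)
  compMap_comp : ∀ {k : ℕ} {j : Fin k → ℕ} {n : ℕ} (h : ∑ i, j i = n) {x x' x'' : ob.obj k}
    {y y' y'' : ∀ i, ob.obj (j i)} (f : x ⟶ x') (f' : x' ⟶ x'') (g : ∀ i, y i ⟶ y' i)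
    (g' : ∀ i, y' i ⟶ y'' i),
    compMap h (f ≫ f') (fun i => g i ≫ g' i) = compMap h f g ≫ compMap h f' g'
  one_actMap : ∀ {n : ℕ} {x x' : ob.obj n} (f : x ⟶ x'), HEq (actMap 1 f) f
  mul_actMap : ∀ {n : ℕ} (a b : G × Perm (Fin n)) {x x' : ob.obj n} (f : x ⟶ x'),
    HEq (actMap (a * b) f) (actMap a (actMap b f))
  one_compMap : ∀ {n : ℕ} (h : ∑ _ : Fin 1, n = n) {x x' : ob.obj n} (f : x ⟶ x'),
    HEq (compMap h (𝟙 ob.one) (fun _ => f)) f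
  compMap_one : ∀ {n : ℕ} (h : ∑ _ : Fin n, 1 = n) {x x' : ob.obj n} (f : x ⟶ x'),
    HEq (compMap h f (fun _ => 𝟙 ob.one)) f
  assocMap : ∀ {k : ℕ} {j : Fin k → ℕ} {m : ℕ} {l : (Σ i, Fin (j i)) → ℕ} {q : Fin k → ℕ} {n : ℕ}
    (h : ∑ i, j i = m) (h' : ∑ p : Fin m, l ((leafEquiv h).symm p) = n)
    (hq : ∀ i, ∑ b, l ⟨i, b⟩ = q i) (h'' : ∑ i, q i = n)
    {x x' : ob.obj k} {y y' : ∀ i, ob.obj (j i)} {z z' : ∀ s, ob.obj (l s)}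
    (e : x ⟶ x') (f : ∀ i, y i ⟶ y' i) (g : ∀ s, z s ⟶ z' s),
    HEq (compMap h' (compMap h e f) (fun p => g ((leafEquiv h).symm p)))
      (compMap h'' e (fun i => compMap (hq i) (f i) (fun b => g ⟨i, b⟩)))
  perm_compMap : ∀ {k : ℕ} {j : Fin k → ℕ} {n : ℕ} (σ : Perm (Fin k)) (h : ∑ i, j i = n)
    (h' : ∑ i, j (σ i) = n) {x x' : ob.obj k} {y y' : ∀ i, ob.obj (j i)}
    (e : x ⟶ x') (f : ∀ i, y i ⟶ y' i),
    HEq (compMap h (actMap (1, σ) e) f)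
      (actMap (1, blockPerm σ h h') (compMap h' e (fun i => f (σ i))))
  compMap_perm : ∀ {k : ℕ} {j : Fin k → ℕ} {n : ℕ} (τ : ∀ i, Perm (Fin (j i)))
    (h : ∑ i, j i = n) {x x' : ob.obj k} {y y' : ∀ i, ob.obj (j i)}
    (e : x ⟶ x') (f : ∀ i, y i ⟶ y' i),
    HEq (compMap h e (fun i => actMap (1, τ i) (f i)))
      (actMap (1, blockSum τ h) (compMap h e f))
  smul_compMap : ∀ {k : ℕ} {j : Fin k → ℕ} {n : ℕ} (g : G) (h : ∑ i, j i = n)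
    {x x' : ob.obj k} {y y' : ∀ i, ob.obj (j i)} (e : x ⟶ x') (f : ∀ i, y i ⟶ y' i),
    HEq (compMap h (actMap (g, 1) e) (fun i => actMap (g, 1) (f i)))
      (actMap (g, 1) (compMap h e f))

attribute [instance] GCatOperad.cat

/-- The subcategory of `O(n)` fixed by `Λ`: its objects and its morphisms are those that are fixed
by every element of `Λ`. -/
def GCatOperad.Fixed {G : Type u} [Group G] (O : GCatOperad G) {n : ℕ}
    (Λ : Subgroup (G × Perm (Fin n))) : Type u :=
  MulAction.fixedPoints Λ (O.ob.obj n)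

theorem heq_comp_of_heq {C : Type u} [SmallCategory C] {x x' y y' z z' : C} (hx : x = x')
    (hy : y = y') (hz : z = z') {f : x ⟶ y} {f' : x' ⟶ y'} {g : y ⟶ z} {g' : y' ⟶ z'}
    (hf : HEq f f') (hg : HEq g g') : HEq (f ≫ g) (f' ≫ g') := by
  subst hx hy hz
  rw [eq_of_heq hf, eq_of_heq hg]

theorem heq_id_of_eq {C : Type u} [SmallCategory C] {x x' : C} (hx : x = x') :
    HEq (𝟙 x) (𝟙 x') := by
  subst hx
  rfl

instance {G : Type u} [Group G] (O : GCatOperad G) {n : ℕ} (Λ : Subgroup (G × Perm (Fin n))) :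
    SmallCategory (O.Fixed Λ) where
  Hom x y := { f : x.1 ⟶ y.1 // ∀ a ∈ Λ, HEq (O.actMap a f) f }
  id x := ⟨𝟙 x.1, fun a ha => by
    rw [O.actMap_id]
    exact heq_id_of_eq (x.2 ⟨a, ha⟩)⟩
  comp {x y z} f g := ⟨f.1 ≫ g.1, fun a ha => by
    rw [O.actMap_comp]
    exact heq_comp_of_heq (x.2 ⟨a, ha⟩) (y.2 ⟨a, ha⟩) (z.2 ⟨a, ha⟩) (f.2 a ha) (g.2 a ha)⟩
  id_comp f := Subtype.ext (Category.id_comp _)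
  comp_id f := Subtype.ext (Category.comp_id _)
  assoc f g h := Subtype.ext (Category.assoc _ _ _)

/-- A small category is contractible if its classifying space, the geometric realization of its
nerve, is. -/
def IsContractibleCat (C : Type u) [SmallCategory C] : Prop :=
  ContractibleSpace (SSet.toTop.obj (nerve C))

/-- An `N∞` operad in `G`-categories: the symmetric groups act freely, the subgroups `H × {e}` have
fixed objects, and every fixed subcategory is empty or contractible. (A permutation that fixes a
morphism fixes its source, so freeness on objects is freeness.) -/
structure GCatOperad.IsNInfty {G : Type u} [Group G] (O : GCatOperad G) : Prop where
  isNSym : O.ob.IsNSym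
  contractible : ∀ n (Λ : Subgroup (G × Perm (Fin n))),
    IsEmpty (O.Fixed Λ) ∨ IsContractibleCat (O.Fixed Λ)

/-- The chaotic category on a set: exactly one morphism between any two objects. -/
abbrev chaoticCategory (X : Type u) : SmallCategory X where
  Hom _ _ := PUnit
  id _ := PUnit.unit
  comp _ _ := PUnit.unit

/-- The operad in `G`-categories obtained from an operad in `G`-sets by replacing every set with the
chaotic category on it. -/
def chaoticOperad {G : Type u} [Group G] (O : GOperad G) : GCatOperad G where
  ob := O
  cat n := chaoticCategory (O.obj n)
  actMap _ _ _ _ := PUnit.unit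
  actMap_id _ _ := rfl
  actMap_comp _ _ _ _ _ _ := rfl
  compMap _ _ _ _ _ _ _ := PUnit.unit
  compMap_id _ _ _ := rfl
  compMap_comp _ _ _ _ _ _ _ _ _ _ _ := rfl
  one_actMap _ := HEq.rfl
  mul_actMap _ _ _ _ _ := HEq.rfl
  one_compMap _ _ _ _ := HEq.rfl
  compMap_one _ _ _ _ := HEq.rfl
  assocMap _ _ _ _ _ _ _ _ _ _ _ _ _ := HEq.rfl
  perm_compMap _ _ _ _ _ _ _ _ _ := HEq.rfl
  compMap_perm _ _ _ _ _ _ _ _ := HEq.rfl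
  smul_compMap _ _ _ _ _ _ _ _ := HEq.rfl

end CategoricalOperads

section TopologicalOperads

/-- An operad in `G`-spaces: an operad in `G`-sets with a topology on each `O(n)` for which the
(discrete) groups `G × Σₙ` act continuously and the compositions are continuous. -/
structure GTopOperad (G : Type u) [Group G] where
  ob : GOperad G
  top : ∀ n, TopologicalSpace (ob.obj n)
  continuous_smul : ∀ n (a : G × Perm (Fin n)), Continuous (fun x : ob.obj n => a • x)
  continuous_comp : ∀ {k : ℕ} {j : Fin k → ℕ} {n : ℕ} (h : ∑ i, j i = n),
    Continuous (fun p : ob.obj k × (∀ i, ob.obj (j i)) => ob.comp h p.1 p.2)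

/-- An operad in compactly generated weak Hausdorff `G`-spaces. The compositions are continuous for
the compactly generated product topology: this means that they are continuous after restriction
along every continuous map from a compact Hausdorff space to the product. -/
structure GCGWHOperad (G : Type u) [Group G] where
  ob : GOperad G
  top : ∀ n, TopologicalSpace (ob.obj n)
  compactlyGenerated : ∀ n, UCompactlyGeneratedSpace.{u} (ob.obj n)
  weakHausdorff : ∀ n (K : Type u) [TopologicalSpace K] [CompactSpace K] [T2Space K]
    (f : K → ob.obj n), Continuous f → IsClosed (Set.range f)
  continuous_smul : ∀ n (a : G × Perm (Fin n)), Continuous (fun x : ob.obj n => a • x)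
  continuous_comp : ∀ {k : ℕ} {j : Fin k → ℕ} {n : ℕ} (h : ∑ i, j i = n)
    (K : Type u) [TopologicalSpace K] [CompactSpace K] [T2Space K]
    (f : K → ob.obj k) (f' : ∀ i, K → ob.obj (j i)), Continuous f → (∀ i, Continuous (f' i)) →
    Continuous (fun p : K => ob.comp h (f p) (fun i => f' i p))

/-- The `N∞` condition on a symmetric sequence of `G`-spaces: the symmetric groups act freely, the
subgroups `H × {e}` have fixed points, and every space of fixed points is empty or contractible. -/
structure GSymSeq.IsNInftyTop {G : Type u} [Group G] (X : GSymSeq G)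
    (top : ∀ n, TopologicalSpace (X.obj n)) : Prop where
  isNSym : X.IsNSym
  contractible : ∀ n (Λ : Subgroup (G × Perm (Fin n))),
    IsEmpty (MulAction.fixedPoints Λ (X.obj n)) ∨
      ContractibleSpace (MulAction.fixedPoints Λ (X.obj n))

/-- `C` is realized by an `N∞` operad in `G`-categories. -/
def CoefSystem.RealizedInGCat {G : Type u} [Group G] (C : CoefSystem G) : Prop :=
  ∃ O : GCatOperad G, O.IsNInfty ∧ O.ob.Realizes C

/-- `C` is realized by an `N∞` operad in `G`-spaces (arbitrary topological spaces). -/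
def CoefSystem.RealizedInGTop {G : Type u} [Group G] (C : CoefSystem G) : Prop :=
  ∃ O : GTopOperad G, O.ob.IsNInftyTop O.top ∧ O.ob.Realizes C

/-- `C` is realized by an `N∞` operad in compactly generated weak Hausdorff `G`-spaces. -/
def CoefSystem.RealizedInGCGWH {G : Type u} [Group G] (C : CoefSystem G) : Prop :=
  ∃ O : GCGWHOperad G, O.ob.IsNInftyTop O.top ∧ O.ob.Realizes C

/-- `C` is realized by a combinatorial operad: an operad in `G`-sets that lies in `NOp`. -/
def CoefSystem.RealizedInNOp {G : Type u} [Group G] (C : CoefSystem G) : Prop :=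
  ∃ O : GOperad G, O.IsNSym ∧ O.Realizes C

end TopologicalOperads

/-!
A coefficient system with an operad that realizes it is closed under the operations of an indexing
system because operations can be composed: if `p : T → B` is a map of finite `H`-sets, an operation
fixed by the graph of `B` can be composed with operations whose inputs are the fibres of `p`, and if
the latter are chosen `H`-equivariantly the composite is fixed by the graph of `T`
(`GOperad.admissible_of_fibres`). Subobjects, coproducts and induced sets are the cases of an
inclusion `T ⊆ B` (insert units and constants), of a map to a two-point set and of
`H ×_K T → H ⧸ K`.

Conversely, let `C` be an indexing system and `S` a symmetric sequence with admissible sets `C`. To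
bound the admissible sets of `𝔽(S)` from above, no solution of its word problem is needed. A choice
of a `Σₙ`-equivariant labelling `Sₙ → Σₙ` gives a map from `S` to the operad of formal terms in the
signature `S`, equivariant for the symmetric groups only. Coinducing from the trivial group makes it
a map of symmetric sequences of `G`-sets, and it extends to a map of operads on `𝔽(S)`
(`exists_termHom`). All variables occur in the terms in its image, so the symmetric groups act
freely on `𝔽(S)` (`freeOperad_isNSym`). Every element of `𝔽(S)` is the unit or a permuted composite
`γ(s; y₁, …, yₖ)` with a generator `s` (`isTree`), and a term determines its outermost operation and
its arguments. Hence, if `H` fixes the term of `γ(s; y₁, …, yₖ)` up to a permutation of the inputs,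
then it acts on `{1, …, k}` compatibly with `s` (`exists_root_perm`), the inputs form an `H`-set `T`
over `{1, …, k}`, and the fibres are the inputs of the `yᵢ`, on which the stabilizers of the `i` act
in the same way. By induction the fibres are in `C`, so `T` is
(`CoefSystem.IsIndexing.mem_of_fibres`, which writes `T` as a coproduct of sets induced from
fibres).

It remains to pass from operads in `G`-sets to categories and spaces.
* The fixed subcategories of a chaotic category are chaotic. A nonempty chaotic category is
  contractible by coning off its nerve from a vertex `c`: the simplex `(x₀, …, xₙ)` is a face of
  `(c, x₀, …, xₙ)`, and straight lines to `c` define a map from the nerve to the singular simplicial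
  set of the path space of its realization (`isContractibleCat_of_isThin`).
* For spaces, a set `X` is replaced by the set of functions `[0, 1) → X` that are continuous from
  the right for the discrete topology, with the metric that measures the set where two functions
  differ. Operations are defined pointwise, hence Lipschitz, fixed points are the functions with
  values in the fixed points, and replacing longer and longer initial segments of a function by a
  constant is a contraction. Being metric, these spaces are compactly generated and Hausdorff.

Finally, every coefficient system is the class of admissible sets of the union of the orbits
`(G × Σₙ) / Γ` over the graphs `Γ` of its members (`CoefSystem.symSeq_realizes`).
-/

/-! ### The classifying space of a chaotic category -/

section Realization

open Simplicial Opposite unitInterval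

/-- The point `(1 - t) e₀ + t p` of the join of a vertex `e₀` with the standard simplex. -/
noncomputable def simplexJoin {n : ℕ} (t : I) (p : stdSimplex ℝ (Fin n)) :
    stdSimplex ℝ (Fin (n + 1)) :=
  ⟨Fin.cons (1 - t : ℝ) (fun i => t * p i), by
    refine ⟨fun i => ?_, ?_⟩
    · induction i using Fin.cases with
      | zero => simpa using t.2.2
      | succ i => exact mul_nonneg t.2.1 (p.2.1 i)
    · have h : ∑ i, p i = 1 := p.2.2
      simp [Fin.sum_univ_succ, ← Finset.mul_sum, h]⟩

theorem continuous_simplexJoin {n : ℕ} :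
    Continuous (fun q : stdSimplex ℝ (Fin n) × I => simplexJoin q.2 q.1) := by
  refine Continuous.subtype_mk (continuous_pi fun i => ?_) _
  induction i using Fin.cases with
  | zero => simp only [Fin.cons_zero]; fun_prop
  | succ i =>
    simp only [Fin.cons_succ]
    have : Continuous fun q : stdSimplex ℝ (Fin n) × I => q.1.1 i :=
      (continuous_apply i).comp (continuous_subtype_val.comp continuous_fst)
    exact (continuous_subtype_val.comp continuous_snd).mul this

theorem simplexJoin_one {n : ℕ} (p : stdSimplex ℝ (Fin n)) :
    simplexJoin 1 p = stdSimplex.map Fin.succ p := by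
  ext i
  rw [stdSimplex.map_coe, FunOnFinite.linearMap_apply_apply]
  induction i using Fin.cases with
  | zero =>
    change (1 - 1 : ℝ) = _
    rw [Finset.sum_eq_zero] <;> simp [Fin.succ_ne_zero]
  | succ i =>
    change (1 : ℝ) * p i = _
    rw [Finset.sum_eq_single i] <;> simp +contextual

theorem simplexJoin_zero {n : ℕ} (p : stdSimplex ℝ (Fin n)) :
    simplexJoin 0 p = stdSimplex.vertex 0 := by
  ext i
  induction i using Fin.cases with
  | zero => change (1 - 0 : ℝ) = _; simp
  | succ i => change (0 : ℝ) * p i = _; simp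

theorem map_simplexJoin {m n : ℕ} (f : Fin m → Fin n) (t : I) (p : stdSimplex ℝ (Fin m)) :
    stdSimplex.map (Fin.cons 0 (fun i => (f i).succ) : Fin (m + 1) → Fin (n + 1))
      (simplexJoin t p) = simplexJoin t (stdSimplex.map f p) := by
  ext i
  rw [stdSimplex.map_coe, FunOnFinite.linearMap_apply_apply, Finset.sum_filter,
    Fin.sum_univ_succ]
  induction i using Fin.cases with
  | zero =>
    change _ = (1 - t : ℝ)
    simp only [Fin.cons_zero, Fin.cons_succ, if_true, Fin.succ_ne_zero, if_false]
    simp [simplexJoin]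
    rfl
  | succ i =>
    change _ = (t : ℝ) * stdSimplex.map f p i
    rw [stdSimplex.map_coe, FunOnFinite.linearMap_apply_apply, Finset.sum_filter, Finset.mul_sum]
    simp only [Fin.cons_zero, Fin.cons_succ, (Fin.succ_ne_zero i).symm, if_false, zero_add,
      Fin.succ_inj]
    refine Finset.sum_congr rfl fun j _ => ?_
    split_ifs
    · rfl
    · simp

/-- The monotone map `{0} ⋆ f` of ordinals. -/
def coneHom {m n : SimplexCategory} (f : m ⟶ n) : ⦋m.len + 1⦌ ⟶ ⦋n.len + 1⦌ :=
  SimplexCategory.Hom.mk ⟨Fin.cons 0 (fun i => (f i).succ), fun i j h => by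
    induction i using Fin.cases with
    | zero => exact Fin.zero_le _
    | succ i =>
      induction j using Fin.cases with
      | zero => simp at h
      | succ j => exact Fin.succ_le_succ_iff.2 (f.toOrderHom.monotone (Fin.succ_le_succ_iff.1 h))⟩

variable {C : Type u} [SmallCategory C] [Quiver.IsThin C]

/-- The simplex of the nerve obtained by prepending an object `c` that maps to all others. -/
noncomputable def coneSimplex (c : C) (hc : ∀ x, Nonempty (c ⟶ x)) {n : SimplexCategory}
    (x : (nerve C).obj (op n)) : (nerve C).obj (op ⦋n.len + 1⦌) :=
  show Fin (n.len + 1 + 1) ⥤ C from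
  { obj := Fin.cons (α := fun _ => C) c (fun i : Fin (n.len + 1) => x.obj i)
    map := fun {i j} f => Nonempty.some (by
      induction i using Fin.cases with
      | zero => exact hc _
      | succ i =>
        induction j using Fin.cases with
        | zero => exact absurd (leOfHom f) (by simp)
        | succ j => exact ⟨x.map (homOfLE (by simpa using leOfHom f))⟩)
    map_id := fun _ => Subsingleton.elim _ _
    map_comp := fun _ _ => Subsingleton.elim _ _ }

theorem coneSimplex_map (c : C) (hc : ∀ x, Nonempty (c ⟶ x)) {m n : SimplexCategory} (f : m ⟶ n)
    (x : (nerve C).obj (op n)) :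
    coneSimplex c hc ((nerve C).map f.op x) = (nerve C).map (coneHom f).op (coneSimplex c hc x) := by
  apply nerve.ext_of_isThin
  funext i
  induction i using Fin.cases with
  | zero => rfl
  | succ i => rfl

/-- The characteristic map of a simplex in the geometric realization. -/
noncomputable def charMap {X : SSet.{u}} {n : SimplexCategory} (x : X.obj (op n)) :
    C(stdSimplex ℝ (Fin (n.len + 1)), SSet.toTop.obj X) :=
  TopCat.toSSetObjEquiv (SSet.toTop.obj X) (op n) ((sSetTopAdj.unit.app X).app (op n) x)

theorem charMap_map {X : SSet.{u}} {m n : SimplexCategory} (f : m ⟶ n) (x : X.obj (op n))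
    (p : stdSimplex ℝ (Fin (m.len + 1))) :
    charMap (X.map f.op x) p = charMap x (stdSimplex.map f p) := by
  have h := ConcreteCategory.congr_hom ((sSetTopAdj.unit.app X).naturality f.op) x
  exact congrArg (fun y => TopCat.toSSetObjEquiv (SSet.toTop.obj X) (op m) y p) h

/-- The contraction of the realization of the nerve, as a map from simplices to paths. -/
noncomputable def coneHomotopy (c : C) (hc : ∀ x, Nonempty (c ⟶ x)) :
    nerve C ⟶ TopCat.toSSet.obj (TopCat.of C(I, SSet.toTop.obj (nerve C))) where
  app n := TypeCat.ofHom fun x => (TopCat.toSSetObjEquiv _ n).symm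
    (ContinuousMap.curry ⟨fun q => charMap (coneSimplex c hc (n := n.unop) x) (simplexJoin q.2 q.1),
      (ContinuousMap.continuous _).comp continuous_simplexJoin⟩)
  naturality n m f := by
    ext x
    apply (TopCat.toSSetObjEquiv _ m).injective
    ext p t
    change charMap (coneSimplex c hc ((nerve C).map f x)) (simplexJoin t p) =
      charMap (coneSimplex c hc x) (simplexJoin t (stdSimplex.map f.unop p))
    rw [← map_simplexJoin, ← f.op_unop, coneSimplex_map, charMap_map]
    rfl

theorem isContractibleCat_of_isThin (c : C) (hc : ∀ x, Nonempty (c ⟶ x)) :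
    IsContractibleCat C := by
  set Y : TopCat.{u} := SSet.toTop.obj (nerve C)
  let F : Y ⟶ TopCat.of C(I, Y) := (sSetTopAdj.homEquiv _ _).symm (coneHomotopy c hc)
  let ev (t : I) : TopCat.of C(I, Y) ⟶ Y := TopCat.ofHom ⟨fun γ => γ t, by fun_prop⟩
  let y₀ : Y := charMap (X := nerve C) (n := ⦋0⦌) (ComposableArrows.mk₀ c) default
  have hF (t : I) : sSetTopAdj.homEquiv _ _ (F ≫ ev t) =
      coneHomotopy c hc ≫ TopCat.toSSet.map (ev t) := by
    rw [Adjunction.homEquiv_naturality_right, Equiv.apply_symm_apply]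
  have h1 : F ≫ ev 1 = 𝟙 Y := by
    apply (sSetTopAdj.homEquiv _ _).injective
    rw [hF, Adjunction.homEquiv_id]
    ext n x
    apply (TopCat.toSSetObjEquiv _ n).injective
    ext p
    change charMap (coneSimplex c hc x) (simplexJoin 1 p) = charMap (n := n.unop) x p
    rw [simplexJoin_one]
    let δ : n.unop ⟶ ⦋n.unop.len + 1⦌ :=
      SimplexCategory.Hom.mk ⟨Fin.succ, Fin.strictMono_succ.monotone⟩
    have hx : (nerve C).map δ.op (coneSimplex c hc x) = x := nerve.ext_of_isThin rfl
    exact (charMap_map δ (coneSimplex c hc x) p).symm.trans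
      (congrArg (fun z => charMap (n := n.unop) z p) hx)
  have h0 : F ≫ ev 0 = TopCat.ofHom (ContinuousMap.const Y y₀) := by
    apply (sSetTopAdj.homEquiv _ _).injective
    rw [hF, Adjunction.homEquiv_unit]
    ext n x
    apply (TopCat.toSSetObjEquiv _ n).injective
    ext p
    change charMap (coneSimplex c hc x) (simplexJoin 0 p) = y₀
    rw [simplexJoin_zero]
    let v : ⦋0⦌ ⟶ ⦋n.unop.len + 1⦌ := SimplexCategory.Hom.mk ⟨fun _ => 0, fun _ _ _ => le_rfl⟩
    have hx : (nerve C).map v.op (coneSimplex c hc x) = ComposableArrows.mk₀ c :=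
      nerve.ext_of_isThin rfl
    have hv : stdSimplex.map v (stdSimplex.vertex (0 : Fin 1)) =
        stdSimplex.vertex (S := ℝ) (0 : Fin (n.unop.len + 2)) := stdSimplex.map_vertex _ _
    rw [← hv]
    refine (charMap_map v (coneSimplex c hc x) _).symm.trans ?_
    rw [hx, Subsingleton.elim (stdSimplex.vertex (S := ℝ) (0 : Fin 1)) default]
  rw [IsContractibleCat, contractible_iff_id_nullhomotopic]
  refine ⟨y₀, ⟨ContinuousMap.Homotopy.symm
    ⟨⟨fun q => (F q.2 : C(I, Y)) q.1, ?_⟩, fun y => ?_, fun y => ?_⟩⟩⟩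
  · exact (ContinuousMap.continuous_uncurry_of_continuous F.hom).comp continuous_swap
  · exact ConcreteCategory.congr_hom h0 y
  · exact ConcreteCategory.congr_hom h1 y

/-- A nonempty chaotic category is contractible. -/
theorem isContractibleCat_of_unique (D : Type u) [SmallCategory D] [Nonempty D]
    [∀ x y : D, Unique (x ⟶ y)] : IsContractibleCat D :=
  have : Quiver.IsThin D := fun _ _ => inferInstance
  isContractibleCat_of_isThin (Classical.arbitrary D) fun _ => ⟨default⟩

theorem chaoticOperad_isNInfty {G : Type u} [Group G] (O : GOperad G) (hO : O.IsNSym) :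
    (chaoticOperad O).IsNInfty where
  isNSym := hO
  contractible n Λ := by
    rcases isEmpty_or_nonempty ((chaoticOperad O).Fixed Λ) with h | h
    · exact Or.inl h
    · have (x y : (chaoticOperad O).Fixed Λ) : Unique (x ⟶ y) :=
        ⟨⟨⟨PUnit.unit, fun _ _ => HEq.rfl⟩⟩, fun _ => rfl⟩
      exact Or.inr (isContractibleCat_of_unique _)

end Realization

/-! ### Operads of step functions -/

section StepFunctions

open Topology MeasureTheory

/-- The functions `[0, 1) → X` that are continuous from the right for the discrete topology on `X`.
Unlike for step functions proper, no finiteness of the set of jumps is required. -/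
def StepFun (X : Type u) : Type u :=
  { f : Set.Ico (0 : ℝ) 1 → X // ∀ s, ∀ᶠ r in 𝓝[≥] s, f r = f s }

namespace StepFun

variable {X Y : Type u}

theorem ext {f g : StepFun X} (h : ∀ s, f.1 s = g.1 s) : f = g :=
  Subtype.ext (funext h)

/-- The constant function. -/
def const (c : X) : StepFun X := ⟨fun _ => c, fun _ => Filter.Eventually.of_forall fun _ => rfl⟩

/-- The set of points at which two functions differ. -/
def diffSet (f g : StepFun X) : Set ℝ := Subtype.val '' {s | f.1 s ≠ g.1 s}

theorem diffSet_subset {f g : StepFun X} {A : Set ℝ} (h : ∀ s, f.1 s ≠ g.1 s → s.1 ∈ A) :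
    diffSet f g ⊆ A := by
  rintro _ ⟨s, hs, rfl⟩
  exact h s hs

theorem mem_diffSet {f g : StepFun X} {s : Set.Ico (0 : ℝ) 1} (h : f.1 s ≠ g.1 s) :
    s.1 ∈ diffSet f g := ⟨s, h, rfl⟩

/-- The distance of two functions is the measure of the set on which they differ. -/
noncomputable instance : EMetricSpace (StepFun X) where
  edist f g := volume (diffSet f g)
  edist_self f := by
    simp [diffSet]
  edist_comm f g := by
    simp only [diffSet, ne_comm]
  edist_triangle f g h := by
    refine (measure_mono (diffSet_subset fun s hs => ?_)).trans (measure_union_le _ _)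
    by_cases hfg : f.1 s = g.1 s
    · exact Or.inr (mem_diffSet fun hgh => hs (hfg.trans hgh))
    · exact Or.inl (mem_diffSet hfg)
  eq_of_edist_eq_zero {f g} h := by
    refine ext fun s => by_contra fun hs => ?_
    -- if `f` and `g` differ at `s`, they differ on some `[s, s + ε)`
    have hev : ∀ᶠ r in 𝓝[≥] s, r.1 ∈ diffSet f g := by
      filter_upwards [f.2 s, g.2 s] with r hf hg
      exact mem_diffSet (by rwa [hf, hg])
    obtain ⟨b, hb, hbs⟩ :
        ∃ b : ℝ, s.1 < b ∧ Set.Ico s.1 b ⊆ diffSet f g := by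
      rw [eventually_nhdsWithin_iff, Metric.eventually_nhds_iff] at hev
      obtain ⟨ε, hε, hev⟩ := hev
      refine ⟨min (s.1 + ε) 1, lt_min (by linarith) s.2.2, fun r hr => ?_⟩
      have h1 := lt_min_iff.1 hr.2
      refine hev (y := ⟨r, s.2.1.trans hr.1, h1.2⟩) ?_ hr.1
      rw [Subtype.dist_eq, Real.dist_eq, abs_lt]
      exact ⟨by simp only; linarith [hr.1], by simp only; linarith [h1.1]⟩
    have h0 : volume (Set.Ico s.1 b) = 0 := measure_mono_null hbs h
    rw [Real.volume_Ico, ENNReal.ofReal_eq_zero] at h0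
    linarith

theorem isClosed_range_of_compactSpace {K : Type*} [TopologicalSpace K] [CompactSpace K]
    {f : K → StepFun X} (hf : Continuous f) : IsClosed (Set.range f) :=
  (isCompact_range hf).isClosed

theorem edist_eq (f g : StepFun X) : edist f g = volume (diffSet f g) := rfl

/-- Pointwise application of a map. -/
def map (φ : X → Y) (f : StepFun X) : StepFun Y :=
  ⟨fun s => φ (f.1 s), fun s => (f.2 s).mono fun _ h => congrArg φ h⟩

theorem continuous_map (φ : X → Y) : Continuous (map φ) := by
  refine LipschitzWith.continuous (K := 1) fun f g => ?_
  rw [ENNReal.coe_one, one_mul]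
  exact measure_mono (diffSet_subset fun s hs => mem_diffSet fun h => hs (congrArg φ h))

/-- Pointwise application of a map with finitely many arguments. -/
def map₂ {ι : Type*} [Finite ι] {Z : ι → Type u} (φ : X → (∀ i, Z i) → Y) (f : StepFun X)
    (g : ∀ i, StepFun (Z i)) : StepFun Y :=
  ⟨fun s => φ (f.1 s) (fun i => (g i).1 s), fun s => by
    filter_upwards [f.2 s, Filter.eventually_all.2 fun i => (g i).2 s] with r h h'
    simp only [h, h']⟩

theorem continuous_map₂ {ι : Type*} [Fintype ι] {Z : ι → Type u} (φ : X → (∀ i, Z i) → Y) :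
    Continuous (fun p : StepFun X × (∀ i, StepFun (Z i)) => map₂ φ p.1 p.2) := by
  refine LipschitzWith.continuous (K := 1 + Fintype.card ι) fun p q => ?_
  have h : diffSet (map₂ φ p.1 p.2) (map₂ φ q.1 q.2) ⊆
      diffSet p.1 q.1 ∪ ⋃ i, diffSet (p.2 i) (q.2 i) := by
    refine diffSet_subset fun s hs => ?_
    by_contra hn
    simp only [Set.mem_union, Set.mem_iUnion, not_or, not_exists] at hn
    have h1 : p.1.1 s = q.1.1 s := by_contra fun hc => hn.1 (mem_diffSet hc)
    have h2 : (fun i => (p.2 i).1 s) = fun i => (q.2 i).1 s :=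
      funext fun i => by_contra fun hc => hn.2 i (mem_diffSet hc)
    exact hs (congrArg₂ φ h1 h2)
  calc edist (map₂ φ p.1 p.2) (map₂ φ q.1 q.2)
      ≤ edist p.1 q.1 + ∑ i, edist (p.2 i) (q.2 i) :=
        (measure_mono h).trans ((measure_union_le _ _).trans
          (add_le_add_right (measure_iUnion_fintype_le _ _) _))
    _ ≤ edist p q + ∑ _ : ι, edist p q := by
        gcongr with i
        · exact le_max_left _ _
        · exact (edist_le_pi_edist _ _ i).trans (le_max_right _ _)
    _ = _ := by simp [add_mul]

theorem continuous_map₂_comp {ι : Type*} [Fintype ι] {Z : ι → Type u} (φ : X → (∀ i, Z i) → Y)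
    {K : Type*} [TopologicalSpace K] {f : K → StepFun X} {g : ∀ i, K → StepFun (Z i)}
    (hf : Continuous f) (hg : ∀ i, Continuous (g i)) :
    Continuous (fun p => map₂ φ (f p) (fun i => g i p)) :=
  (continuous_map₂ φ).comp (hf.prodMk (continuous_pi hg))

/-- The function that is `c` before time `t` and `f` from then on. -/
noncomputable def splice (c : X) (t : ℝ) (f : StepFun X) : StepFun X :=
  ⟨fun s => open Classical in if s.1 < t then c else f.1 s, fun s => by
    rcases lt_or_ge s.1 t with h | h
    · have : ∀ᶠ r : Set.Ico (0 : ℝ) 1 in 𝓝[≥] s, r.1 < t :=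
        nhdsWithin_le_nhds (continuous_subtype_val.continuousAt.eventually_lt_const h)
      filter_upwards [this] with r hr
      simp only [h, hr, if_true]
    · filter_upwards [f.2 s, self_mem_nhdsWithin] with r hr hs
      rw [if_neg h.not_gt, if_neg (h.trans hs).not_gt, hr]⟩

theorem splice_zero (c : X) (f : StepFun X) : splice c 0 f = f :=
  ext fun s => if_neg s.2.1.not_gt

theorem splice_one (c : X) (f : StepFun X) : splice c 1 f = const c :=
  ext fun s => if_pos s.2.2

theorem continuous_splice (c : X) :
    Continuous (fun p : ℝ × StepFun X => splice c p.1 p.2) := by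
  refine LipschitzWith.continuous (K := 2) fun p q => ?_
  have h : diffSet (splice c p.1 p.2) (splice c q.1 q.2) ⊆
      Set.uIcc q.1 p.1 ∪ diffSet p.2 q.2 := by
    refine diffSet_subset fun s hs => ?_
    by_contra hn
    rw [Set.mem_union, not_or] at hn
    have h1 : p.2.1 s = q.2.1 s := by_contra fun hc => hn.2 (mem_diffSet hc)
    have h2 : s.1 < p.1 ↔ s.1 < q.1 := by
      rw [Set.mem_uIcc] at hn
      grind
    exact hs (by simp only [splice, h1, h2])
  calc edist (splice c p.1 p.2) (splice c q.1 q.2)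
      ≤ edist p.1 q.1 + edist p.2 q.2 := by
        refine (measure_mono h).trans ((measure_union_le _ _).trans_eq ?_)
        rw [Set.uIcc, Real.volume_Icc, max_sub_min_eq_abs', ← Real.dist_eq, ← edist_dist, edist_comm,
          edist_eq p.2]
    _ ≤ edist p q + edist p q := add_le_add (le_max_left _ _) (le_max_right _ _)
    _ = _ := by norm_num [two_mul]

/-- A set of functions that contains the constant function `c` and is closed under replacing an
initial segment by `c` is contractible. -/
theorem contractibleSpace_of_splice_mem (F : Set (StepFun X)) (c : X) (hc : const c ∈ F)
    (hF : ∀ t, ∀ f ∈ F, splice c t f ∈ F) : ContractibleSpace F := by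
  rw [contractible_iff_id_nullhomotopic]
  refine ⟨⟨const c, hc⟩, ⟨⟨⟨fun p => ⟨splice c p.1 p.2.1, hF _ _ p.2.2⟩, ?_⟩,
    fun f => ?_, fun f => ?_⟩⟩⟩
  · exact ((continuous_splice c).comp ((continuous_subtype_val.comp continuous_fst).prodMk
      (continuous_subtype_val.comp continuous_snd))).subtype_mk _
  · exact Subtype.ext (splice_zero c f.1)
  · exact Subtype.ext (splice_one c f.1)

end StepFun

open StepFun

variable {G : Type u} [Group G]

/-- The symmetric sequence of step functions with values in a symmetric sequence. -/
def stepSymSeq (X : GSymSeq G) : GSymSeq G where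
  obj n := StepFun (X.obj n)
  action _ :=
    { smul := fun a => StepFun.map (a • ·)
      one_smul := fun _ => StepFun.ext fun _ => one_smul _ _
      mul_smul := fun _ _ _ => StepFun.ext fun _ => mul_smul _ _ _ }

/-- The operad of step functions with values in an operad, with the pointwise operations. -/
def stepOperad (O : GOperad G) : GOperad G where
  toGSymSeq := stepSymSeq O.toGSymSeq
  one := const O.one
  comp h x y := map₂ (O.comp h) x y
  one_comp h x := StepFun.ext fun s => O.one_comp h (x.1 s)
  comp_one h x := StepFun.ext fun s => O.comp_one h (x.1 s)
  assoc h h' hq h'' x y z := StepFun.ext fun s =>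
    O.assoc h h' hq h'' (x.1 s) (fun i => (y i).1 s) (fun i => (z i).1 s)
  perm_comp σ h h' x y := StepFun.ext fun s => O.perm_comp σ h h' (x.1 s) (fun i => (y i).1 s)
  comp_perm τ h x y := StepFun.ext fun s => O.comp_perm τ h (x.1 s) (fun i => (y i).1 s)
  smul_one g := StepFun.ext fun _ => O.smul_one g
  smul_comp g h x y := StepFun.ext fun s => O.smul_comp g h (x.1 s) (fun i => (y i).1 s)

theorem const_mem_fixedPoints {X : GSymSeq G} {n : ℕ} {Λ : Subgroup (G × Perm (Fin n))}
    {x : X.obj n} (hx : x ∈ MulAction.fixedPoints Λ (X.obj n)) :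
    (const x : (stepSymSeq X).obj n) ∈ MulAction.fixedPoints Λ ((stepSymSeq X).obj n) :=
  fun a => StepFun.ext fun _ => hx a

theorem eval_mem_fixedPoints {X : GSymSeq G} {n : ℕ} {Λ : Subgroup (G × Perm (Fin n))}
    {f : (stepSymSeq X).obj n} (hf : f ∈ MulAction.fixedPoints Λ ((stepSymSeq X).obj n))
    (s : Set.Ico (0 : ℝ) 1) : f.1 s ∈ MulAction.fixedPoints Λ (X.obj n) :=
  fun a => congrFun (congrArg Subtype.val (hf a)) s

theorem nonempty_fixedPoints_stepSymSeq_iff (X : GSymSeq G) {n : ℕ}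
    (Λ : Subgroup (G × Perm (Fin n))) :
    (MulAction.fixedPoints Λ ((stepSymSeq X).obj n)).Nonempty ↔
      (MulAction.fixedPoints Λ (X.obj n)).Nonempty :=
  ⟨fun ⟨_, hf⟩ => ⟨_, eval_mem_fixedPoints hf ⟨0, by simp⟩⟩,
    fun ⟨_, hx⟩ => ⟨_, const_mem_fixedPoints hx⟩⟩

theorem stepSymSeq_realizes_iff (X : GSymSeq G) (C : CoefSystem G) :
    (stepSymSeq X).Realizes C ↔ X.Realizes C := by
  simp only [GSymSeq.Realizes, GSymSeq.Admissible, nonempty_fixedPoints_stepSymSeq_iff]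

/-- The topology on step functions given by the distance. -/
noncomputable abbrev stepTop (X : GSymSeq G) (n : ℕ) : TopologicalSpace ((stepSymSeq X).obj n) :=
  inferInstanceAs (TopologicalSpace (StepFun (X.obj n)))

theorem stepSymSeq_isNInftyTop {X : GSymSeq G} (hX : X.IsNSym) :
    (stepSymSeq X).IsNInftyTop (stepTop X) where
  isNSym :=
    { free := fun n σ f h => hX.free n σ (f.1 ⟨0, by simp⟩)
        (congrFun (congrArg Subtype.val h) ⟨0, by simp⟩)
      fixed := fun n H => (nonempty_fixedPoints_stepSymSeq_iff X _).2 (hX.fixed n H) }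
  contractible n Λ := by
    rcases isEmpty_or_nonempty (MulAction.fixedPoints Λ ((stepSymSeq X).obj n)) with h | ⟨⟨f, hf⟩⟩
    · exact Or.inl h
    right
    obtain ⟨x, hx⟩ := (nonempty_fixedPoints_stepSymSeq_iff X Λ).1 ⟨f, hf⟩
    refine contractibleSpace_of_splice_mem (MulAction.fixedPoints Λ ((stepSymSeq X).obj n)) x
      (const_mem_fixedPoints hx) fun t f hf a => StepFun.ext fun s => ?_
    by_cases hs : s.1 < t
    · have h : (splice x t f).1 s = x := if_pos hs
      exact (congrArg (a • ·) h).trans ((hx a).trans h.symm)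
    · have h : (splice x t f).1 s = f.1 s := if_neg hs
      exact (congrArg (a • ·) h).trans ((eval_mem_fixedPoints hf s a).trans h.symm)

theorem realizedInGTop_of_realizedInNOp {C : CoefSystem G} (h : C.RealizedInNOp) :
    C.RealizedInGTop := by
  obtain ⟨O, hO, hC⟩ := h
  exact ⟨{ ob := stepOperad O
           top := stepTop O.toGSymSeq
           continuous_smul := fun _ _ => StepFun.continuous_map _
           continuous_comp := fun h => StepFun.continuous_map₂ (O.comp h) },
    stepSymSeq_isNInftyTop hO, (stepSymSeq_realizes_iff _ C).2 hC⟩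

theorem realizedInGCGWH_of_realizedInNOp {C : CoefSystem G} (h : C.RealizedInNOp) :
    C.RealizedInGCGWH := by
  obtain ⟨O, hO, hC⟩ := h
  exact ⟨{ ob := stepOperad O
           top := stepTop O.toGSymSeq
           compactlyGenerated := fun n =>
             inferInstanceAs (UCompactlyGeneratedSpace.{u} (StepFun (O.obj n)))
           weakHausdorff := fun _ _ _ _ _ _ hf => StepFun.isClosed_range_of_compactSpace hf
           continuous_smul := fun _ _ => StepFun.continuous_map _
           continuous_comp := fun h _ _ _ _ _ _ hf hf' =>
             StepFun.continuous_map₂_comp (O.comp h) hf hf' },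
    stepSymSeq_isNInftyTop hO, (stepSymSeq_realizes_iff _ C).2 hC⟩

end StepFunctions

/-! ### Composition of operations along a map of finite sets -/

section Composition

variable {G : Type u} [Group G]

/-- Admissibility via an enumeration `ι` of `T`: the fixed point condition is spelled out for each
`h` and the permutation `σ` of the labels that it induces. -/
theorem GSymSeq.admissible_iff {X : GSymSeq G} {H : Subgroup G} {T : Type u} [MulAction H T] :
    X.Admissible H T ↔ ∃ (n : ℕ) (ι : Fin n ≃ T) (x : X.obj n),
      ∀ (h : H) (σ : Perm (Fin n)), (∀ m, h • ι m = ι (σ m)) → ((h : G), σ) • x = x := by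
  constructor
  · rintro ⟨n, e, x, hx⟩
    refine ⟨n, e.symm, x, fun h σ hσ => ?_⟩
    have h1 := hx ⟨_, ⟨h, rfl⟩⟩
    convert h1 using 1
    change ((h : G), σ) • x = ((h : G), e.permCongr (MulAction.toPerm h)) • x
    congr 2
    ext1 m
    simp [hσ]
  · rintro ⟨n, ι, x, hx⟩
    refine ⟨n, ι.symm, x, ?_⟩
    rintro ⟨_, h, rfl⟩
    exact hx h (ι.symm.permCongr (MulAction.toPerm h)) (by simp)

/-- Transport along a bijection `Fin a ≃ Fin b` of the sets of inputs, which forces `a = b`. -/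
def GSymSeq.relabel (X : GSymSeq G) {a b : ℕ} (ρ : Fin a ≃ Fin b) (x : X.obj a) : X.obj b :=
  have h : a = b := Fin.equiv_iff_eq.1 ⟨ρ⟩
  h ▸ (((1, ρ.trans (finCongr h.symm)) : G × Perm (Fin a)) • x)

theorem GSymSeq.relabel_perm (X : GSymSeq G) {a : ℕ} (σ : Perm (Fin a)) (x : X.obj a) :
    X.relabel σ x = ((1, σ) : G × Perm (Fin a)) • x := rfl

theorem blockSum_leafEquiv {k : ℕ} {j : Fin k → ℕ} {n : ℕ} (τ : ∀ i, Perm (Fin (j i)))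
    (h : ∑ i, j i = n) (i : Fin k) (m : Fin (j i)) :
    blockSum τ h (leafEquiv h ⟨i, m⟩) = leafEquiv h ⟨i, τ i m⟩ := by
  simp [blockSum]

theorem blockPerm_leafEquiv {k : ℕ} {j : Fin k → ℕ} {n : ℕ} (σ : Perm (Fin k))
    (h : ∑ i, j i = n) (h' : ∑ i, j (σ i) = n) (i : Fin k) (m : Fin (j (σ i))) :
    blockPerm σ h h' (leafEquiv h' ⟨i, m⟩) = leafEquiv h ⟨σ i, m⟩ := by
  simp [blockPerm]

/-- The equivariance of composition: permuting the inputs of `x` by `σ` while relabelling the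
inputs of the `yᵢ` by `ρᵢ` permutes the inputs of the composite by `(i, m) ↦ (σ i, ρᵢ m)`. -/
theorem GOperad.comp_relabel (O : GOperad G) {k : ℕ} {j j' : Fin k → ℕ} {n : ℕ}
    (h : ∑ i, j i = n) (h' : ∑ i, j' i = n) (σ : Perm (Fin k))
    (ρ : ∀ i, Fin (j i) ≃ Fin (j' (σ i))) (g : G) (x : O.obj k) (y : ∀ i, O.obj (j i))
    (y' : ∀ i, O.obj (j' i))
    (hy : ∀ i, y' (σ i) = O.relabel (ρ i) (((g, 1) : G × Perm (Fin (j i))) • y i))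
    (π : Perm (Fin n)) (hπ : ∀ i m, π (leafEquiv h ⟨i, m⟩) = leafEquiv h' ⟨σ i, ρ i m⟩) :
    O.comp h' (((g, σ) : G × Perm (Fin k)) • x) y' =
      ((g, π) : G × Perm (Fin n)) • O.comp h x y := by
  obtain rfl : j = fun i => j' (σ i) := funext fun i => Fin.equiv_iff_eq.1 ⟨ρ i⟩
  have hx : ((g, σ) : G × Perm (Fin k)) • x =
      ((1, σ) : G × Perm (Fin k)) • ((g, 1) : G × Perm (Fin k)) • x := by simp [← mul_smul]
  have hy' : (fun i => y' (σ i)) = fun i =>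
      ((1, ρ i) : G × Perm (Fin (j' (σ i)))) • ((g, 1) : G × Perm (Fin (j' (σ i)))) • y i :=
    funext fun i => by rw [hy]; exact GSymSeq.relabel_perm _ _ _
  rw [hx, O.perm_comp σ h' h, hy', O.comp_perm (τ := ρ), O.smul_comp, ← mul_smul, ← mul_smul]
  congr 1
  refine Prod.ext (by simp) (Equiv.ext fun p => ?_)
  obtain ⟨⟨i, m⟩, rfl⟩ := (leafEquiv h).surjective p
  simp only [Prod.mk_mul_mk, mul_one, Perm.mul_apply]
  rw [hπ, blockSum_leafEquiv, blockPerm_leafEquiv]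

/-- Composition in an operad along a map of `H`-sets `p : T → B`, from a coherent family of
operations `y b` whose inputs are labelled by the fibres of `p`. -/
theorem GOperad.admissible_of_family (O : GOperad G) {H : Subgroup G} {T B : Type u}
    [MulAction H T] [MulAction H B] (p : T → B) (hp : ∀ (h : H) t, p (h • t) = h • p t)
    (hB : O.Admissible H B) (N : B → ℕ) (ι : ∀ b, Fin (N b) → T)
    (hι : ∀ b, Function.Injective (ι b)) (hr : ∀ b t, p t = b ↔ t ∈ Set.range (ι b))
    (y : ∀ b, O.obj (N b))
    (hy : ∀ (h : H) (b b' : B), h • b = b' → ∀ ρ : Fin (N b) ≃ Fin (N b'),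
      (∀ m, h • ι b m = ι b' (ρ m)) →
        O.relabel ρ ((((h : G), 1) : G × Perm (Fin (N b))) • y b) = y b') :
    O.Admissible H T := by
  rw [GSymSeq.admissible_iff] at hB ⊢
  obtain ⟨k, e, x, hx⟩ := hB
  have hpι (b m) : p (ι b m) = b := (hr b _).2 ⟨m, rfl⟩
  let f : (Σ i, Fin (N (e i))) → T := fun s => ι (e s.1) s.2
  have hf : Function.Bijective f := by
    constructor
    · rintro ⟨i, m⟩ ⟨i', m'⟩ hs
      obtain rfl : i = i' := e.injective (by rw [← hpι (e i) m, ← hpι (e i') m']; exact congrArg p hs)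
      obtain rfl : m = m' := hι _ hs
      rfl
    · intro t
      obtain ⟨m, hm⟩ := (hr (e (e.symm (p t))) t).1 (by simp)
      exact ⟨⟨_, m⟩, hm⟩
  let E := Equiv.ofBijective f hf
  refine ⟨∑ i, N (e i), (leafEquiv rfl).symm.trans E, O.comp rfl x (fun i => y (e i)),
    fun h π hπ => ?_⟩
  have hπ' (i m) : h • ι (e i) m = E ((leafEquiv rfl).symm (π (leafEquiv rfl ⟨i, m⟩))) := by
    have := hπ (leafEquiv rfl ⟨i, m⟩)
    rwa [Equiv.trans_apply, Equiv.symm_apply_apply] at this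
  let σ : Perm (Fin k) := (e.trans (MulAction.toPerm h)).trans e.symm
  have hσ (i) : h • e i = e (σ i) := by simp [σ]
  have key (i) : ∃ ρ : Fin (N (e i)) ≃ Fin (N (e (σ i))), ∀ m, h • ι (e i) m = ι (e (σ i)) (ρ m) := by
    have h1 (m) : ∃ m', ι (e (σ i)) m' = h • ι (e i) m :=
      (hr _ _).1 (by rw [hp, hpι, hσ])
    choose r hr1 using h1
    refine ⟨Equiv.ofBijective r ⟨fun a b hab => hι (e i) ?_, fun m' => ?_⟩, fun m => (hr1 m).symm⟩
    · apply MulAction.injective h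
      simp only
      rw [← hr1, ← hr1, hab]
    · obtain ⟨m, hm⟩ := (hr (e i) (h⁻¹ • ι (e (σ i)) m')).1 (by
        rw [hp, hpι, ← hσ, inv_smul_smul])
      exact ⟨m, hι _ (by rw [hr1, hm, smul_inv_smul])⟩
  choose ρ hρ using key
  have h2 := O.comp_relabel rfl rfl σ ρ (h : G) x (fun i => y (e i)) (fun i => y (e i))
    (fun i => (hy h _ _ (hσ i) (ρ i) (hρ i)).symm) π (fun i m => by
      apply (leafEquiv _).symm.injective
      apply E.injective
      rw [← hπ', Equiv.symm_apply_apply, hρ]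
      rfl)
  rw [← h2, hx h σ hσ]

/-- If `B` is admissible for an operad and `p : T → B` is a map of `H`-sets such that one fibre over
each orbit of `B` is admissible for the stabilizer of its base point, then `T` is admissible. -/
theorem GOperad.admissible_of_fibres (O : GOperad G) {H : Subgroup G} {T B : Type u}
    [MulAction H T] [MulAction H B] (p : T → B) (hp : ∀ (h : H) t, p (h • t) = h • p t)
    (hB : O.Admissible H B)
    (hfib : ∀ b : B, ∃ b₀ : B, (∃ k : H, k • b₀ = b) ∧ ∃ (n : ℕ) (ι : Fin n → T) (y : O.obj n),
      Function.Injective ι ∧ (∀ t, p t = b₀ ↔ t ∈ Set.range ι) ∧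
      ∀ h : H, h • b₀ = b₀ → ∀ σ : Perm (Fin n), (∀ m, h • ι m = ι (σ m)) → ((h : G), σ) • y = y) :
    O.Admissible H T := by
  -- choose one base point `b₀ q` in each orbit `q`, and `k b` that moves it to `b`
  have hq (q : MulAction.orbitRel.Quotient H B) := hfib q.out
  choose b₀ hb₀ n ι y hι hr hy using hq
  let cl : B → MulAction.orbitRel.Quotient H B := Quotient.mk _
  have hk (b : B) : ∃ k : H, k • b₀ (cl b) = b := by
    obtain ⟨k, hk⟩ := hb₀ (cl b)
    obtain ⟨l, hl⟩ : b ∈ MulAction.orbit H (cl b).out :=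
      MulAction.orbitRel_apply.1 (Setoid.symm' _ (Quotient.mk_out (s := MulAction.orbitRel H B) b))
    exact ⟨l * k, by rw [mul_smul, hk]; exact hl⟩
  choose k hk using hk
  refine O.admissible_of_family p hp hB (fun b => n (cl b)) (fun b m => k b • ι (cl b) m)
    (fun b => (MulAction.injective _).comp (hι _)) (fun b t => ?_)
    (fun b => (((k b : G), 1) : G × Perm (Fin (n (cl b)))) • y (cl b)) (fun h b b' hb ρ hρ => ?_)
  · have h1 : p t = b ↔ p ((k b)⁻¹ • t) = b₀ (cl b) := by rw [hp, inv_smul_eq_iff, hk]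
    rw [h1, hr]
    exact exists_congr fun m => eq_inv_smul_iff
  · have hbb : cl b = cl b' :=
      Quotient.sound (MulAction.orbitRel_apply.2 ⟨h⁻¹, by rw [← hb]; simp⟩)
    have h1 := hk b
    have h2 := hk b'
    revert ρ h1 h2
    generalize k b = l, k b' = l'
    generalize cl b = q at hbb ⊢
    generalize cl b' = q' at hbb ⊢
    subst hbb
    intro ρ hρ h1 h2
    have h3 := hy q (l'⁻¹ * (h * l)) (by rw [mul_smul, mul_smul, h1, hb, ← h2, inv_smul_smul]) ρ
      (fun m => by rw [mul_smul, mul_smul, hρ, inv_smul_smul])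
    rw [GSymSeq.relabel_perm, ← mul_smul, ← mul_smul]
    conv_rhs => rw [← h3, ← mul_smul]
    simp

end Composition

/-! ### Admissible sets of an operad form an indexing system -/

section IndexingOfOperad

variable {G : Type u} [Group G]

/-- The admissible sets of a combinatorial operad form an indexing system: each closure property
is an instance of composing operations along a map of `H`-sets. -/
theorem isIndexing_of_realizedInNOp {C : CoefSystem G} (hC : C.RealizedInNOp) : C.IsIndexing := by
  obtain ⟨O, hO, hC⟩ := hC
  refine ⟨fun H T T' _ _ i hi he hT' => ?_, fun H T T' _ _ hT hT' => ?_,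
    fun K H hK T _ hT hHK => ?_⟩
  · -- the fibres of `i` are empty or singletons: insert constants and units
    rw [← hC] at hT' ⊢
    refine O.admissible_of_fibres i he hT' fun b => ⟨b, ⟨1, one_smul _ _⟩, ?_⟩
    by_cases hb : ∃ t, i t = b
    · obtain ⟨t, rfl⟩ := hb
      refine ⟨1, fun _ => t, O.one, fun _ _ _ => Subsingleton.elim _ _, fun t' => ?_,
        fun h _ σ _ => ?_⟩
      · simp [hi.eq_iff, eq_comm]
      · rw [Subsingleton.elim σ 1, O.smul_one]
    · obtain ⟨c, hc⟩ := hO.fixed 0 ⊤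
      refine ⟨0, Fin.elim0, c, fun a => a.elim0, fun t' => ?_, fun h _ σ _ => ?_⟩
      · simpa using fun hh => hb ⟨t', hh⟩
      · exact hc ⟨(h, σ), by simp [Subgroup.mem_prod, Subsingleton.elim σ 1]⟩
  · -- `T ⊕ T'` maps to a two-point set with trivial action
    let : MulAction H (ULift.{u} Bool) :=
      { smul := fun _ b => b, one_smul := fun _ => rfl, mul_smul := fun _ _ _ => rfl }
    have hB : C.mem H (ULift.{u} Bool) := C.trivial _ _ fun _ _ => rfl
    rw [← hC] at hT hT' hB ⊢
    rw [GSymSeq.admissible_iff] at hT hT'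
    obtain ⟨n, ι, x, hx⟩ := hT
    obtain ⟨n', ι', x', hx'⟩ := hT'
    refine O.admissible_of_fibres
      (Sum.elim (fun _ => ULift.up true) (fun _ => ULift.up false) : T ⊕ T' → ULift.{u} Bool)
      (by rintro h (t | t) <;> rfl) hB ?_
    rintro ⟨_ | _⟩
    · refine ⟨_, ⟨1, rfl⟩, n', Sum.inr ∘ ι', x', Sum.inr_injective.comp ι'.injective, ?_,
        fun h _ σ hσ => hx' h σ fun m => Sum.inr_injective (hσ m)⟩
      rintro (t | t)
      · simp
      · simp
    · refine ⟨_, ⟨1, rfl⟩, n, Sum.inl ∘ ι, x, Sum.inl_injective.comp ι.injective, ?_,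
        fun h _ σ hσ => hx h σ fun m => Sum.inl_injective (hσ m)⟩
      rintro (t | t)
      · simp
      · simp
  · -- `H ×_K T` maps to `H ⧸ K` with fibre `T` over the trivial coset
    rw [← hC] at hT hHK ⊢
    rw [GSymSeq.admissible_iff] at hT
    obtain ⟨n, ι, x, hx⟩ := hT
    have hmk {s t : T} : (Quotient.mk (indSetoid hK T) (1, s)) = Quotient.mk _ (1, t) → s = t := by
      intro hst
      obtain ⟨k, h1, h2⟩ := Quotient.exact hst
      have : k = 1 := by
        apply Subgroup.inclusion_injective hK
        simpa [eq_comm] using h1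
      simpa [this, eq_comm] using h2
    let p : Ind hK T → H ⧸ K.subgroupOf H := Quotient.lift (fun q => (q.1 : H ⧸ K.subgroupOf H)) (by
      rintro q r ⟨k, h1, -⟩
      apply (QuotientGroup.eq.2 _).symm
      rw [h1, inv_mul_cancel_left]
      exact k.2)
    refine O.admissible_of_fibres p ?_ hHK fun b => ⟨((1 : H) : H ⧸ K.subgroupOf H), ?_, n,
      fun m => Quotient.mk _ (1, ι m), x, fun m m' hm => ι.injective (hmk hm), ?_, ?_⟩
    · rintro h ⟨q⟩
      rfl
    · obtain ⟨h, rfl⟩ := QuotientGroup.mk_surjective b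
      exact ⟨h, by simp⟩
    · rintro ⟨⟨h, t⟩⟩
      constructor
      · intro hp
        have hh : (h : G) ∈ K := by
          have := QuotientGroup.eq.1 (show ((h : H) : H ⧸ K.subgroupOf H) = ((1 : H) : _) from hp)
          simpa [Subgroup.mem_subgroupOf] using this
        refine ⟨ι.symm ((⟨h, hh⟩ : K) • t), Quotient.sound' (Setoid.symm' (indSetoid hK T) ?_)⟩
        refine ⟨⟨h, hh⟩, ?_, by simp⟩
        ext; simp
      · rintro ⟨m, hm⟩
        exact (congrArg p hm).symm
    · intro h hh σ hσ
      have hh : (h : G) ∈ K := by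
        have := QuotientGroup.eq.1 (show ((h * 1 : H) : H ⧸ K.subgroupOf H) = ((1 : H) : _) from hh)
        simpa [Subgroup.mem_subgroupOf] using this
      refine hx ⟨h, hh⟩ σ fun m => hmk (Eq.trans ?_ (hσ m))
      refine Quotient.sound' (Setoid.symm' (indSetoid hK T) ⟨⟨h, hh⟩, ?_, rfl⟩)
      ext; simp

end IndexingOfOperad

/-! ### Lexicographic numbering of leaves -/

section LeafNumbering

theorem sigmaLex_or {k : ℕ} {j : Fin k → ℕ} (s s' : Σ i, Fin (j i)) :
    Sigma.Lex (· < ·) (fun _ => (· < ·)) s s' ∨ s = s' ∨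
      Sigma.Lex (· < ·) (fun _ => (· < ·)) s' s := by
  obtain ⟨i, m⟩ := s
  obtain ⟨i', m'⟩ := s'
  rcases lt_trichotomy i i' with h | rfl | h
  · exact Or.inl (Sigma.Lex.left _ _ h)
  · rcases lt_trichotomy m m' with h | rfl | h
    · exact Or.inl (Sigma.Lex.right _ _ h)
    · exact Or.inr (Or.inl rfl)
    · exact Or.inr (Or.inr (Sigma.Lex.right _ _ h))
  · exact Or.inr (Or.inr (Sigma.Lex.left _ _ h))

theorem leafEquiv_val {k : ℕ} {j : Fin k → ℕ} {n : ℕ} (h : ∑ i, j i = n) (i : Fin k)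
    (m : Fin (j i)) : (leafEquiv h ⟨i, m⟩ : ℕ) = ∑ x ∈ Finset.Iio i, j x + m := by
  have h1 : (leafEquiv h ⟨i, m⟩ : ℕ) = (finSigmaFinEquiv ⟨i, m⟩ : Fin _) := by simp [leafEquiv]
  rw [h1, finSigmaFinEquiv_apply]
  congr 1
  refine Finset.sum_bij (fun x _ => Fin.castLE i.2.le x) (fun x _ => ?_) (fun x _ y _ hxy => ?_)
    (fun y hy => ⟨⟨y, ?_⟩, Finset.mem_univ _, rfl⟩) fun x _ => rfl
  · rw [Finset.mem_Iio, Fin.lt_def]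
    exact x.2
  · exact Fin.castLE_injective _ hxy
  · exact Fin.lt_def.1 (Finset.mem_Iio.1 hy)

/-- The numbering of the leaves is strictly monotone for the lexicographic order. -/
theorem leafEquiv_lt_of_lex {k : ℕ} {j : Fin k → ℕ} {n : ℕ} (h : ∑ i, j i = n)
    {s s' : Σ i, Fin (j i)} (hs : Sigma.Lex (· < ·) (fun _ => (· < ·)) s s') :
    leafEquiv h s < leafEquiv h s' := by
  rw [Fin.lt_def]
  cases hs with
  | @left i i' m m' hi =>
    rw [leafEquiv_val, leafEquiv_val]
    have h1 : ∑ x ∈ Finset.Iic i, j x ≤ ∑ x ∈ Finset.Iio i', j x :=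
      Finset.sum_le_sum_of_subset fun x hx =>
        Finset.mem_Iio.2 ((Finset.mem_Iic.1 hx).trans_lt hi)
    have h2 : ∑ x ∈ Finset.Iic i, j x = ∑ x ∈ Finset.Iio i, j x + j i := by
      rw [← Finset.Iio_insert, Finset.sum_insert (by simp), add_comm]
    have := m.2
    omega
  | @right i m m' hm =>
    rw [leafEquiv_val, leafEquiv_val]
    exact Nat.add_lt_add_left hm _

theorem lex_of_leafEquiv_lt {k : ℕ} {j : Fin k → ℕ} {n : ℕ} (h : ∑ i, j i = n)
    {s s' : Σ i, Fin (j i)} (hs : leafEquiv h s < leafEquiv h s') :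
    Sigma.Lex (· < ·) (fun _ => (· < ·)) s s' := by
  rcases sigmaLex_or s s' with h1 | rfl | h1
  · exact h1
  · exact absurd hs (lt_irrefl _)
  · exact absurd hs (leafEquiv_lt_of_lex h h1).not_gt

theorem lex_leafEquiv_of_lex {k : ℕ} {j : Fin k → ℕ} {l : (Σ i, Fin (j i)) → ℕ} {q : Fin k → ℕ}
    (hq : ∀ i, ∑ b, l ⟨i, b⟩ = q i) {t t' : Σ i, Fin (j i)}
    (ht : Sigma.Lex (· < ·) (fun _ => (· < ·)) t t') (c : Fin (l t)) (c' : Fin (l t')) :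
    Sigma.Lex (α := fun i => Fin (q i)) (· < ·) (fun _ => (· < ·))
      ⟨t.1, leafEquiv (hq t.1) ⟨t.2, c⟩⟩ ⟨t'.1, leafEquiv (hq t'.1) ⟨t'.2, c'⟩⟩ := by
  cases ht with
  | left _ _ hi => exact Sigma.Lex.left _ _ hi
  | right _ _ hb =>
    exact Sigma.Lex.right _ _ (leafEquiv_lt_of_lex _ (Sigma.Lex.left _ _ hb))

/-- The two ways of numbering the leaves of a tree with three levels agree, since both respect the
lexicographic order. -/
theorem leafEquiv_assoc {k : ℕ} {j : Fin k → ℕ} {m : ℕ} {l : (Σ i, Fin (j i)) → ℕ} {q : Fin k → ℕ}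
    {n : ℕ} (h : ∑ i, j i = m) (h' : ∑ p : Fin m, l ((leafEquiv h).symm p) = n)
    (hq : ∀ i, ∑ b, l ⟨i, b⟩ = q i) (h'' : ∑ i, q i = n) (p : Fin m)
    (c : Fin (l ((leafEquiv h).symm p))) :
    leafEquiv h' ⟨p, c⟩ = leafEquiv h'' ⟨((leafEquiv h).symm p).1,
      leafEquiv (hq _) ⟨((leafEquiv h).symm p).2, c⟩⟩ := by
  let f : (Σ p, Fin (l ((leafEquiv h).symm p))) → Fin n := fun s =>
    leafEquiv h'' ⟨((leafEquiv h).symm s.1).1, leafEquiv (hq _) ⟨((leafEquiv h).symm s.1).2, s.2⟩⟩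
  have hf : StrictMono (fun x => f ((leafEquiv h').symm x)) := by
    intro x y hxy
    obtain ⟨s, rfl⟩ := (leafEquiv h').surjective x
    obtain ⟨s', rfl⟩ := (leafEquiv h').surjective y
    simp only [Equiv.symm_apply_apply]
    have hs := lex_of_leafEquiv_lt h' hxy
    clear hxy
    cases hs with
    | @left p p' c c' hp =>
      apply leafEquiv_lt_of_lex
      dsimp only
      have hp' : Sigma.Lex (· < ·) (fun _ => (· < ·)) ((leafEquiv h).symm p)
          ((leafEquiv h).symm p') := lex_of_leafEquiv_lt h (by simpa using hp)
      exact lex_leafEquiv_of_lex hq hp' c c'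
    | @right p c c' hc =>
      exact leafEquiv_lt_of_lex _ (Sigma.Lex.right _ _ (leafEquiv_lt_of_lex _
        (Sigma.Lex.right _ _ hc)))
  have hid : (fun x => f ((leafEquiv h').symm x)) = id :=
    (hf.range_inj strictMono_id).1 (by
      rw [(Finite.injective_iff_surjective.1 hf.injective).range_eq, Set.range_id])
  have := congrFun hid (leafEquiv h' ⟨p, c⟩)
  rw [Equiv.symm_apply_apply] at this
  exact this.symm

end LeafNumbering

/-! ### Terms and substitution -/

section Terms

/-- Formal terms with variables in `X` in a signature with a set `R k` of `k`-ary operations. -/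
inductive OpTerm (R : ℕ → Type u) (X : Type) : Type u
  | var (x : X) : OpTerm R X
  | node {k : ℕ} (r : R k) (t : Fin k → OpTerm R X) : OpTerm R X

namespace OpTerm

variable {R : ℕ → Type u} {X Y Z : Type}

/-- Substitution of terms for the variables. -/
def bind (f : X → OpTerm R Y) : OpTerm R X → OpTerm R Y
  | var x => f x
  | node r t => node r (fun i => (t i).bind f)

/-- Renaming of the variables. -/
def map (f : X → Y) (t : OpTerm R X) : OpTerm R Y := t.bind (fun x => var (f x))

/-- The set of variables that occur in a term. -/
def vars : OpTerm R X → Set X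
  | var x => {x}
  | node _ t => ⋃ i, (t i).vars

theorem bind_var (t : OpTerm R X) : t.bind var = t := by
  induction t with
  | var x => rfl
  | node r t ih => simp only [bind, ih]

theorem bind_bind (f : X → OpTerm R Y) (g : Y → OpTerm R Z) (t : OpTerm R X) :
    (t.bind f).bind g = t.bind (fun x => (f x).bind g) := by
  induction t with
  | var x => rfl
  | node r t ih => simp only [bind, ih]

theorem map_id (t : OpTerm R X) : t.map (fun x => x) = t := bind_var t

theorem map_map (f : X → Y) (g : Y → Z) (t : OpTerm R X) :
    (t.map f).map g = t.map (fun x => g (f x)) := bind_bind _ _ _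

theorem bind_map (f : X → Y) (g : Y → OpTerm R Z) (t : OpTerm R X) :
    (t.map f).bind g = t.bind (fun x => g (f x)) := bind_bind _ _ _

theorem map_bind (f : X → OpTerm R Y) (g : Y → Z) (t : OpTerm R X) :
    (t.bind f).map g = t.bind (fun x => (f x).map g) := bind_bind _ _ _

theorem vars_bind (f : X → OpTerm R Y) (t : OpTerm R X) :
    (t.bind f).vars = ⋃ x ∈ t.vars, (f x).vars := by
  induction t with
  | var x => simp [bind, vars]
  | node r t ih =>
    simp only [bind, vars, ih]
    ext y
    simp only [Set.mem_iUnion]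
    grind

theorem vars_map (f : X → Y) (t : OpTerm R X) : (t.map f).vars = f '' t.vars := by
  ext y
  simp [map, vars_bind, vars, eq_comm]

theorem map_injective {f : X → Y} (hf : Function.Injective f) :
    Function.Injective (map (R := R) f) := by
  intro t
  induction t with
  | var x =>
    rintro (y | ⟨r, t'⟩) h
    · exact congrArg var (hf (by simpa [map, bind] using h))
    · simp [map, bind] at h
  | node r t ih =>
    rintro (y | @⟨k, r', t'⟩) h
    · simp [map, bind] at h
    · simp only [map, bind, node.injEq] at h
      obtain ⟨rfl, h1, h2⟩ := h
      rw [eq_of_heq h1]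
      congr 1
      funext i
      exact ih i (congrFun (eq_of_heq h2) i)

theorem eq_of_map_eq_self {f : X → X} {t : OpTerm R X} (h : t.map f = t) {x : X}
    (hx : x ∈ t.vars) : f x = x := by
  induction t with
  | var y =>
    obtain rfl : x = y := hx
    simpa [map, bind] using h
  | node r t ih =>
    obtain ⟨i, hi⟩ := Set.mem_iUnion.1 hx
    simp only [map, bind, node.injEq, heq_eq_eq, true_and] at h
    exact ih i (congrFun h i) hi

end OpTerm

end Terms

/-! ### The coinduced operad of terms -/

section TermOperad

open OpTerm

variable {G : Type u} [Group G]

/-- The symmetric sequence coinduced along `1 → G` from the terms in `n` variables: its elements are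
functions from `G` to terms, and `G` acts by translation of the argument. Variables may be repeated
or omitted. -/
def termSymSeq (G : Type u) [Group G] (R : ℕ → Type u) : GSymSeq G where
  obj n := G → OpTerm R (Fin n)
  action n :=
    { smul := fun a f x => (f (x * a.1)).map a.2
      one_smul := fun f => funext fun x => by
        change (f (x * 1)).map (fun i => i) = f x
        rw [mul_one, map_id]
      mul_smul := fun a b f => funext fun x => by
        change (f (x * (a.1 * b.1))).map (fun i => a.2 (b.2 i)) =
          ((f (x * a.1 * b.1)).map b.2).map a.2
        rw [map_map, mul_assoc] }

theorem termSymSeq_smul {R : ℕ → Type u} {n : ℕ} (a : G × Perm (Fin n))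
    (f : (termSymSeq G R).obj n) (x : G) : (a • f) x = (f (x * a.1)).map a.2 := rfl

/-- The operad structure on `termSymSeq`: substitution of terms, with the variables of the
substituted terms renumbered. -/
def termOperad (G : Type u) [Group G] (R : ℕ → Type u) : GOperad G where
  toGSymSeq := termSymSeq G R
  one := fun _ => var 0
  comp h f y := fun x => (f x).bind (fun i => (y i x).map (fun m => leafEquiv h ⟨i, m⟩))
  one_comp h f := funext fun x => by
    change (f x).map _ = f x
    conv_rhs => rw [← map_id (f x)]
    congr 1
    funext m
    ext
    rw [leafEquiv_val]
    simp
  comp_one h f := funext fun x => by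
    conv_rhs => rw [← bind_var (f x)]
    congr 1
    funext m
    change var _ = _
    congr 1
    ext
    rw [leafEquiv_val]
    simp
  assoc h h' hq h'' f y z := funext fun x => by
    change ((f x).bind _).bind _ = (f x).bind fun i => OpTerm.map _ ((y i x).bind _)
    simp only [bind_bind, map_bind, bind_map, map_map]
    congr 1
    funext i
    congr 1
    funext b
    obtain ⟨p, hp⟩ := (leafEquiv h).symm.surjective ⟨i, b⟩
    obtain rfl : leafEquiv h ⟨i, b⟩ = p := by rw [← hp, Equiv.apply_symm_apply]
    simp only [leafEquiv_assoc h h' hq h'']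
    generalize (leafEquiv h).symm (leafEquiv h ⟨i, b⟩) = s at hp
    subst hp
    rfl
  perm_comp σ h h' f y := funext fun x => by
    change ((f (x * 1)).map σ).bind _ = OpTerm.map _ ((f (x * 1)).bind _)
    simp only [map_bind, bind_map, map_map, blockPerm_leafEquiv, mul_one]
  comp_perm τ h f y := funext fun x => by
    change (f x).bind (fun i => OpTerm.map _ (OpTerm.map (τ i) (y i (x * 1)))) =
      OpTerm.map _ ((f (x * 1)).bind _)
    simp only [map_bind, map_map, blockSum_leafEquiv, mul_one]
  smul_one g := rfl
  smul_comp g h f y := funext fun x => by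
    change (OpTerm.map (fun i => i) (f (x * g))).bind
      (fun i => OpTerm.map _ (OpTerm.map (fun i => i) (y i (x * g)))) =
      OpTerm.map (fun i => i) ((f (x * g)).bind _)
    simp only [map_id]

end TermOperad

/-! ### Normal forms in the free operad -/

section NormalForm

variable {G : Type u} [Group G] {S : GSymSeq G}

/-- The elements of the free operad built from the unit by grafting generators at the root and
permuting the inputs. -/
inductive IsTree (S : GSymSeq G) : ∀ {n : ℕ}, (freeOperad S).obj n → Prop
  | one : IsTree S (freeOperad S).one
  | node {k : ℕ} {j : Fin k → ℕ} {n : ℕ} (h : ∑ i, j i = n) (σ : Perm (Fin n)) (s : S.obj k)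
      (y : ∀ i, (freeOperad S).obj (j i)) (hy : ∀ i, IsTree S (y i)) :
      IsTree S (((1, σ) : G × Perm (Fin n)) •
        (freeOperad S).comp h ((freeUnit S).app k s) y)

theorem IsTree.comp_gen {k : ℕ} {j : Fin k → ℕ} {n : ℕ} (h : ∑ i, j i = n) (s : S.obj k)
    (y : ∀ i, (freeOperad S).obj (j i)) (hy : ∀ i, IsTree S (y i)) :
    IsTree S ((freeOperad S).comp h ((freeUnit S).app k s) y) := by
  have := IsTree.node h 1 s y hy
  rwa [← Prod.one_eq_mk, one_smul] at this

theorem IsTree.smul {n : ℕ} {x : (freeOperad S).obj n} (hx : IsTree S x)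
    (a : G × Perm (Fin n)) : IsTree S (a • x) := by
  obtain ⟨g, σ⟩ := a
  induction hx with
  | one =>
    rw [Subsingleton.elim σ 1, (freeOperad S).smul_one]
    exact .one
  | @node k j n h τ s y _ ih =>
    have h1 : ((g, σ) : G × Perm (Fin n)) • ((1, τ) : G × Perm (Fin n)) •
        (freeOperad S).comp h ((freeUnit S).app k s) y = ((1, σ * τ) : G × Perm (Fin n)) •
          (freeOperad S).comp h ((freeUnit S).app k (((g, 1) : G × Perm (Fin k)) • s))
            (fun i => ((g, 1) : G × Perm (Fin (j i))) • y i) := by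
      rw [(freeUnit S).map_smul, (freeOperad S).smul_comp, ← mul_smul, ← mul_smul]
      simp
    rw [h1]
    exact .node h _ _ _ fun i => ih i 1

theorem IsTree.comp_comp_gen {k : ℕ} {j : Fin k → ℕ} {m : ℕ} {n : ℕ} (h : ∑ i, j i = m)
    (s : S.obj k) (w : ∀ i, (freeOperad S).obj (j i))
    (hw : ∀ (i : Fin k) {l : Fin (j i) → ℕ} {q : ℕ} (hq : ∑ b, l b = q)
      (z : ∀ b, (freeOperad S).obj (l b)), (∀ b, IsTree S (z b)) →
        IsTree S ((freeOperad S).comp hq (w i) z))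
    {l : Fin m → ℕ} (h' : ∑ p, l p = n) (z : ∀ p, (freeOperad S).obj (l p))
    (hz : ∀ p, IsTree S (z p)) :
    IsTree S ((freeOperad S).comp h' ((freeOperad S).comp h ((freeUnit S).app k s) w) z) := by
  -- index `l` and `z` by pairs instead of by their numbers, as the associativity law does
  obtain ⟨l, rfl⟩ : ∃ l' : (Σ i, Fin (j i)) → ℕ, l = fun p => l' ((leafEquiv h).symm p) :=
    ⟨fun t => l (leafEquiv h t), by simp⟩
  obtain ⟨z, rfl⟩ : ∃ z' : ∀ t, (freeOperad S).obj (l t), z = fun p => z' ((leafEquiv h).symm p) :=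
    ⟨(Equiv.piCongrLeft' (fun t => (freeOperad S).obj (l t)) (leafEquiv h)).symm z,
      ((Equiv.piCongrLeft' (fun t => (freeOperad S).obj (l t)) (leafEquiv h)).apply_symm_apply
        z).symm⟩
  have hz' (t) : IsTree S (z t) := by
    obtain ⟨p, rfl⟩ := (leafEquiv h).symm.surjective t
    exact hz p
  have h'' : ∑ i, ∑ b, l ⟨i, b⟩ = n := by
    rw [← h', ← Fintype.sum_sigma, Equiv.sum_comp (leafEquiv h).symm]
  rw [(freeOperad S).assoc h h' (fun i => rfl) h'']
  exact .comp_gen _ _ _ fun i => hw i rfl _ fun b => hz' _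

theorem IsTree.comp {k : ℕ} {x : (freeOperad S).obj k} (hx : IsTree S x) {j : Fin k → ℕ} {n : ℕ}
    (h : ∑ i, j i = n) (y : ∀ i, (freeOperad S).obj (j i)) (hy : ∀ i, IsTree S (y i)) :
    IsTree S ((freeOperad S).comp h x y) := by
  induction hx generalizing n with
  | one =>
    obtain rfl : j = fun _ => n := by
      funext i
      rw [Fin.fin_one_eq_zero i, ← h]
      simp
    have h0 : y = fun _ => y 0 := funext fun i => by rw [Fin.fin_one_eq_zero i]
    rw [h0, (freeOperad S).one_comp]
    exact hy 0
  | node h₀ σ s w _ ih =>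
    rw [(freeOperad S).perm_comp σ h ((Equiv.sum_comp σ j).trans h)]
    exact (IsTree.comp_comp_gen h₀ s w (fun i _ _ hq z hz => ih i hq z hz) _ _
      fun i => hy _).smul _

theorem isTree {n : ℕ} (x : (freeOperad S).obj n) : IsTree S x := by
  obtain ⟨t, rfl⟩ := freeMk_surjective x
  induction t with
  | @gen n s =>
    have h : ∑ _ : Fin n, 1 = n := by simp
    have := IsTree.comp_gen h s (fun _ => (freeOperad S).one) fun _ => .one
    rwa [(freeOperad S).comp_one] at this
  | one => exact .one
  | act a t ih => exact ih.smul a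
  | comp h t v ih ih' =>
    rw [← freeComp_freeMk]
    exact ih.comp h (fun i => freeMk (v i)) ih'

end NormalForm

/-! ### The free operad is free over the symmetric groups -/

section TermsOfFree

open OpTerm

variable {G : Type u} [Group G] {S : GSymSeq G}

/-- A free `Σₙ`-set has an equivariant map to `Σₙ`. -/
theorem GSymSeq.IsNSym.exists_labelling (hS : S.IsNSym) (n : ℕ) :
    ∃ c : S.obj n → Perm (Fin n), ∀ (τ : Perm (Fin n)) (s : S.obj n),
      c (((1, τ) : G × Perm (Fin n)) • s) = τ * c s := by
  let r : Setoid (S.obj n) :=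
    { r := fun s t => ∃ τ : Perm (Fin n), ((1, τ) : G × Perm (Fin n)) • s = t
      iseqv :=
        { refl := fun s => ⟨1, one_smul _ s⟩
          symm := by
            rintro s _ ⟨τ, rfl⟩
            exact ⟨τ⁻¹, by simp [← mul_smul, ← Prod.one_eq_mk]⟩
          trans := by
            rintro s _ _ ⟨τ, rfl⟩ ⟨τ', rfl⟩
            exact ⟨τ' * τ, by simp [← mul_smul]⟩ } }
  have hc (s : S.obj n) : ∃ τ : Perm (Fin n),
      ((1, τ) : G × Perm (Fin n)) • (Quotient.mk r s).out = s := Quotient.mk_out (s := r) s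
  choose c hc using hc
  refine ⟨c, fun τ s => ?_⟩
  have h1 := hc (((1, τ) : G × Perm (Fin n)) • s)
  have h2 : Quotient.mk r (((1, τ) : G × Perm (Fin n)) • s) = Quotient.mk r s :=
    Quotient.sound (Setoid.symm' r ⟨τ, rfl⟩)
  rw [h2] at h1
  have h3 : ((1, (τ * c s)⁻¹ * c (((1, τ) : G × Perm (Fin n)) • s)) : G × Perm (Fin n)) •
      (Quotient.mk r s).out = (Quotient.mk r s).out := by
    rw [← one_mul (1 : G), ← Prod.mk_mul_mk, mul_smul, one_mul, h1]
    nth_rewrite 2 [← hc s]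
    rw [← mul_smul, ← mul_smul]
    simp [← Prod.one_eq_mk]
  exact (inv_mul_eq_one.1 (hS.free n _ _ h3)).symm

variable (c : ∀ n, S.obj n → Perm (Fin n))
  (hc : ∀ n (τ : Perm (Fin n)) (s : S.obj n), c n (((1, τ) : G × Perm (Fin n)) • s) = τ * c n s)

/-- The map that sends `s` to the function `x ↦ x s` on `G`, where an element `t = τ t₀` with label
`c t = τ` is represented by the term `t₀ (τ 1, …, τ n)`. -/
def termUnit : GSymSeq.Hom S (termOperad G S.obj).toGSymSeq where
  app n s := fun x : G =>
    node (((x, (c n (((x, 1) : G × Perm (Fin n)) • s))⁻¹) : G × Perm (Fin n)) • s)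
      (fun i => var (c n (((x, 1) : G × Perm (Fin n)) • s) i))
  map_smul n a s := funext fun x : G => by
    have h1 : ((x, 1) : G × Perm (Fin n)) • a • s =
        ((1, a.2) : G × Perm (Fin n)) • ((x * a.1, 1) : G × Perm (Fin n)) • s := by
      rw [← mul_smul, ← mul_smul]
      congr 1
      ext1 <;> simp
    refine Eq.trans ?_ (termSymSeq_smul a _ x).symm
    simp only [h1, hc, OpTerm.map, OpTerm.bind, Perm.mul_apply]
    congr 1
    rw [← mul_smul]
    congr 1
    ext1 <;> simp

theorem termUnit_comp_apply {k : ℕ} {j : Fin k → ℕ} {n : ℕ} (h : ∑ i, j i = n) (s : S.obj k)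
    (y : ∀ i, (termOperad G S.obj).obj (j i)) (x : G) :
    (termOperad G S.obj).comp h ((termUnit c hc).app k s) y x =
      node (((x, (c k (((x, 1) : G × Perm (Fin k)) • s))⁻¹) : G × Perm (Fin k)) • s)
        (fun i => (y (c k (((x, 1) : G × Perm (Fin k)) • s) i) x).map
          (fun m => leafEquiv h ⟨_, m⟩)) := rfl

/-- Every variable occurs in the terms of an element of the free operad. -/
theorem IsTree.vars_eq_univ (F : GOperad.Hom (freeOperad S) (termOperad G S.obj))
    (hF : ∀ n (s : S.obj n), F.app n ((freeUnit S).app n s) = (termUnit c hc).app n s)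
    {n : ℕ} {y : (freeOperad S).obj n} (hy : IsTree S y) (x : G) :
    (F.app n y x).vars = Set.univ := by
  induction hy generalizing x with
  | one =>
    rw [F.map_one]
    exact Set.eq_univ_of_forall fun i => Subsingleton.elim _ _
  | @node k j n h σ s y _ ih =>
    rw [F.map_smul]
    refine (congrArg OpTerm.vars (termSymSeq_smul _ _ x)).trans ?_
    have hcomp : F.app n ((freeOperad S).comp h ((freeUnit S).app k s) y) = (termOperad G S.obj).comp
        h ((termUnit c hc).app k s) (fun i => F.app (j i) (y i)) := by
      rw [F.map_comp, hF]
    rw [hcomp, termUnit_comp_apply, vars_map]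
    refine (congrArg _ (Set.eq_univ_of_forall fun p => ?_)).trans
      (Set.image_univ_of_surjective σ.surjective)
    obtain ⟨⟨i, m⟩, rfl⟩ := (leafEquiv h).surjective p
    obtain ⟨i, rfl⟩ := (c k (((x * 1, 1) : G × Perm (Fin k)) • s)).surjective i
    refine Set.mem_iUnion.2 ⟨i, ?_⟩
    rw [vars_map, ih]
    exact ⟨m, trivial, rfl⟩

/-- The free operad on `S` maps to the operad of terms in such a way that generators go to
operations applied to variables. -/
theorem exists_termHom : ∃ F : GOperad.Hom (freeOperad S) (termOperad G S.obj),
    ∀ n (s : S.obj n), F.app n ((freeUnit S).app n s) = (termUnit c hc).app n s :=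
  (freeOperad_universal S _ (termUnit c hc)).exists

theorem freeOperad_isNSym (hS : S.IsNSym) : (freeOperad S).IsNSym where
  free n σ x hx := by
    choose c hc using hS.exists_labelling
    obtain ⟨F, hF⟩ := exists_termHom c hc
    have h1 := F.map_smul n (1, σ) x
    rw [hx] at h1
    have h2 := (congrFun h1 1).trans (termSymSeq_smul _ _ _)
    rw [mul_one] at h2
    ext1 i
    exact eq_of_map_eq_self h2.symm (by
      rw [(isTree x).vars_eq_univ c hc F hF]
      trivial)
  fixed n H := by
    obtain ⟨s, hs⟩ := hS.fixed n H
    exact ⟨(freeUnit S).app n s, fun a =>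
      ((freeUnit S).map_smul n a.1 s).symm.trans (congrArg _ (hs a))⟩

theorem GSymSeq.IsNSym.perm_unique (hS : S.IsNSym) {n : ℕ} {s : S.obj n} {g : G}
    {α β : Perm (Fin n)} (hα : ((g, α) : G × Perm (Fin n)) • s = s)
    (hβ : ((g, β) : G × Perm (Fin n)) • s = s) : α = β := by
  have h1 : ((1, β⁻¹ * α) : G × Perm (Fin n)) • s = s := by
    have : ((1, β⁻¹ * α) : G × Perm (Fin n)) = (g, β)⁻¹ * (g, α) := by simp
    rw [this, mul_smul, hα, inv_smul_eq_iff, hβ]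
  exact (inv_mul_eq_one.1 (hS.free n _ s h1)).symm

/-- A symmetry of a tree with root `s` comes from a symmetry of `s` that permutes the branches,
because a term determines its outermost operation and its arguments. -/
theorem exists_root_perm (hS : S.IsNSym) {k : ℕ} {j : Fin k → ℕ} {n : ℕ} (h : ∑ i, j i = n)
    (s : S.obj k) (Y : ∀ i, (termOperad G S.obj).obj (j i)) (g : G) (π : Perm (Fin n))
    (hfix : ((g, π) : G × Perm (Fin n)) • (termOperad G S.obj).comp h ((termUnit c hc).app k s) Y =
      (termOperad G S.obj).comp h ((termUnit c hc).app k s) Y) :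
    ∃ β : Perm (Fin k), ((g, β) : G × Perm (Fin k)) • s = s ∧ ∀ i (x : G),
      OpTerm.map (fun m => π (leafEquiv h ⟨i, m⟩)) (Y i (x * g)) =
        OpTerm.map (fun m => leafEquiv h ⟨β i, m⟩) (Y (β i) x) := by
  let c' (x : G) : Perm (Fin k) := c k (((x, 1) : G × Perm (Fin k)) • s)
  have hx (x : G) : node (((x * g, (c' (x * g))⁻¹) : G × Perm (Fin k)) • s)
        (fun i => OpTerm.map π (OpTerm.map (fun m => leafEquiv h ⟨c' (x * g) i, m⟩)
          (Y (c' (x * g) i) (x * g)))) =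
      node (((x, (c' x)⁻¹) : G × Perm (Fin k)) • s)
        (fun i => OpTerm.map (fun m => leafEquiv h ⟨c' x i, m⟩) (Y (c' x i) x)) :=
    congrFun hfix x
  simp only [node.injEq, heq_eq_eq, true_and, map_map] at hx
  have hγ (x : G) : ((g, c' x * (c' (x * g))⁻¹) : G × Perm (Fin k)) • s = s := by
    have h1 := congrArg (((x⁻¹, c' x) : G × Perm (Fin k)) • ·) (hx x).1
    simpa [← mul_smul, ← Prod.one_eq_mk] using h1
  refine ⟨c' 1 * (c' (1 * g))⁻¹, hγ 1, fun i x => ?_⟩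
  rw [hS.perm_unique (hγ 1) (hγ x)]
  obtain ⟨i, rfl⟩ := (c' (x * g)).surjective i
  have h2 : c' x i = (c' x * (c' (x * g))⁻¹) (c' (x * g) i) := by simp
  rw [← h2]
  exact congrFun (hx x).2 i

end TermsOfFree

/-! ### Indexing systems and fibrations -/

section Fibrations

variable {G : Type u} [Group G]

/-- The action of `H` on an invariant subset. -/
abbrev subAction {H : Subgroup G} {T : Type u} [MulAction H T] (P : T → Prop)
    (hP : ∀ (h : H) t, P t → P (h • t)) : MulAction H {t // P t} where
  smul h t := ⟨h • t.1, hP h _ t.2⟩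
  one_smul _ := Subtype.ext (one_smul _ _)
  mul_smul _ _ _ := Subtype.ext (mul_smul _ _ _)

/-- The subgroup of `G` of those elements of `H` that fix `b`. -/
def stabilizerIn (H : Subgroup G) {B : Type u} [MulAction H B] (b : B) : Subgroup G :=
  (MulAction.stabilizer H b).map H.subtype

theorem stabilizerIn_le (H : Subgroup G) {B : Type u} [MulAction H B] (b : B) :
    stabilizerIn H b ≤ H := by
  rintro _ ⟨h, -, rfl⟩
  exact h.2

theorem mem_stabilizerIn {H : Subgroup G} {B : Type u} [MulAction H B] {b : B} {h : H} :
    (h : G) ∈ stabilizerIn H b ↔ h • b = b := by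
  constructor
  · rintro ⟨h', h1, h2⟩
    obtain rfl : h' = h := Subtype.ext h2
    exact h1
  · exact fun h1 => ⟨h, h1, rfl⟩

/-- The action of the stabilizer of `b` on the fibre over `b`. -/
abbrev fibreAction {H : Subgroup G} {T B : Type u} [MulAction H T] [MulAction H B] (p : T → B)
    (hp : ∀ (h : H) t, p (h • t) = h • p t) (b : B) :
    MulAction (stabilizerIn H b) {t // p t = b} where
  smul k t := ⟨Subgroup.inclusion (stabilizerIn_le H b) k • t.1, by
    rw [hp, t.2]
    exact mem_stabilizerIn.1 k.2⟩
  one_smul t := Subtype.ext (one_smul _ _)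
  mul_smul k l t := Subtype.ext (mul_smul (Subgroup.inclusion (stabilizerIn_le H b) k)
    (Subgroup.inclusion (stabilizerIn_le H b) l) t.1)

/-- The part of `T` over the orbit of `b` is induced from the fibre over `b`. -/
theorem CoefSystem.IsIndexing.mem_over_orbit {C : CoefSystem G} (hC : C.IsIndexing)
    {H : Subgroup G} {T B : Type u} [MulAction H T] [MulAction H B] (p : T → B)
    (hp : ∀ (h : H) t, p (h • t) = h • p t) (hB : C.mem H B) (b : B)
    (hF : @CoefSystem.mem _ _ C (stabilizerIn H b) {t // p t = b} (fibreAction p hp b)) :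
    @CoefSystem.mem _ _ C H {t // ∃ h : H, h • b = p t}
      (subAction _ fun h t ⟨l, hl⟩ => ⟨h * l, by rw [hp, ← hl, mul_smul]⟩) := by
  let := fibreAction p hp b
  let : MulAction H {t // ∃ h : H, h • b = p t} :=
    subAction _ fun h t ⟨l, hl⟩ => ⟨h * l, by rw [hp, ← hl, mul_smul]⟩
  have hK := stabilizerIn_le H b
  have horb : C.mem H (H ⧸ (stabilizerIn H b).subgroupOf H) := by
    have hrel (h h' : H) : h⁻¹ * h' ∈ (stabilizerIn H b).subgroupOf H ↔ h • b = h' • b := by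
      rw [Subgroup.mem_subgroupOf, mem_stabilizerIn, mul_smul, inv_smul_eq_iff, eq_comm]
    refine hC.sub H _ B (Quotient.lift (fun h : H => h • b) fun h h' hh =>
      (hrel h h').1 (QuotientGroup.leftRel_apply.1 hh)) ?_ ?_ hB
    · rintro ⟨h⟩ ⟨h'⟩ hh
      exact QuotientGroup.eq.2 ((hrel h h').2 hh)
    · rintro h ⟨h'⟩
      exact mul_smul h h' b
  have hInd := hC.ind _ H hK _ hF horb
  let f : Ind hK {t // p t = b} → {t // ∃ h : H, h • b = p t} :=
    Quotient.lift (fun q => ⟨q.1 • q.2.1, q.1, by rw [hp, q.2.2]⟩) (by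
      rintro ⟨h, t⟩ ⟨h', t'⟩ ⟨k, h1, h2⟩
      obtain rfl : h = h' * Subgroup.inclusion hK k := h1
      obtain rfl : t' = k • t := h2
      refine Subtype.ext ?_
      change (h' * Subgroup.inclusion hK k) • t.1 = h' • Subgroup.inclusion hK k • t.1
      rw [mul_smul])
  have hf : Function.Bijective f := by
    constructor
    · rintro ⟨h, t⟩ ⟨h', t'⟩ hh
      have h1 : h • t.1 = h' • t'.1 := congrArg Subtype.val hh
      have h2 : h • b = h' • b := by
        have := congrArg p h1
        rwa [hp, hp, t.2, t'.2] at this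
      refine Quotient.sound' ⟨⟨(h'⁻¹ * h : H), mem_stabilizerIn.2 ?_⟩, ?_, Subtype.ext ?_⟩
      · rw [mul_smul, h2, inv_smul_smul]
      · ext; simp
      · change t'.1 = (h'⁻¹ * h : H) • t.1
        rw [mul_smul, h1, inv_smul_smul]
    · rintro ⟨t, h, hh⟩
      exact ⟨Quotient.mk _ (h, ⟨h⁻¹ • t, by rw [hp, ← hh, inv_smul_smul]⟩),
        Subtype.ext (smul_inv_smul h t)⟩
  refine C.iso H _ _ (Equiv.ofBijective f hf) ?_ hInd
  rintro h ⟨h', t⟩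
  exact Subtype.ext (mul_smul h h' t.1)

/-- For an indexing system, if `B` is admissible and `p : T → B` is a map of `H`-sets whose fibres
are admissible for the subgroups that fix their base points, then `T` is admissible. -/
theorem CoefSystem.IsIndexing.mem_of_fibres {C : CoefSystem G} (hC : C.IsIndexing)
    {H : Subgroup G} {T B : Type u} [MulAction H T] [MulAction H B] (p : T → B)
    (hp : ∀ (h : H) t, p (h • t) = h • p t) (hB : C.mem H B)
    (hF : ∀ (b : B) (K : Subgroup G) (hK : K ≤ H), (∀ k : K, Subgroup.inclusion hK k • b = b) →
      ∀ (F : Type u) [MulAction K F] (f : F → T), Function.Injective f →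
        (∀ (k : K) x, f (k • x) = Subgroup.inclusion hK k • f x) →
        (∀ t, p t = b ↔ t ∈ Set.range f) → C.mem K F) :
    C.mem H T := by
  have := C.finite H B hB
  induction hn : Nat.card B using Nat.strong_induction_on generalizing T B with
  | h n ih =>
  rcases isEmpty_or_nonempty B with hBe | ⟨⟨b⟩⟩
  · have : IsEmpty T := ⟨fun t => hBe.elim (p t)⟩
    exact C.trivial H T fun _ t => this.elim t
  have h1 := hC.mem_over_orbit p hp hB b (by
    let := fibreAction p hp b
    exact hF b _ (stabilizerIn_le H b) (fun k => mem_stabilizerIn.1 k.2) _ Subtype.val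
      Subtype.val_injective (fun _ _ => rfl) (by simp))
  have hT : ∀ (h : H) t, (∃ l : H, l • b = p t) → ∃ l : H, l • b = p (h • t) :=
    fun h t ⟨l, hl⟩ => ⟨h * l, by rw [hp, ← hl, mul_smul]⟩
  have hT' : ∀ (h : H) t, (¬ ∃ l : H, l • b = p t) → ¬ ∃ l : H, l • b = p (h • t) :=
    fun h t ht ⟨l, hl⟩ => ht ⟨h⁻¹ * l, by rw [mul_smul, hl, hp, inv_smul_smul]⟩
  have hB' : ∀ (h : H) b', (¬ ∃ l : H, l • b = b') → ¬ ∃ l : H, l • b = h • b' :=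
    fun h t ht ⟨l, hl⟩ => ht ⟨h⁻¹ * l, by rw [mul_smul, hl, inv_smul_smul]⟩
  let := subAction _ hT
  let := subAction _ hT'
  let := subAction _ hB'
  have h2 : C.mem H {t // ¬ ∃ l : H, l • b = p t} := by
    refine ih (Nat.card {b' // ¬ ∃ l : H, l • b = b'}) ?_
      (fun t : {t // ¬ ∃ l : H, l • b = p t} =>
        (⟨p t.1, t.2⟩ : {b' // ¬ ∃ l : H, l • b = b'}))
      (fun h t => Subtype.ext (hp h t.1)) (hC.sub H _ B Subtype.val Subtype.val_injective
        (fun _ _ => rfl) hB) (fun b' K hK hb' F _ f hf hfe hfr => ?_) inferInstance rfl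
    · rw [← hn]
      exact Finite.card_subtype_lt (x := b) (fun hh => hh ⟨1, one_smul _ _⟩)
    · refine hF b'.1 K hK (fun k => congrArg Subtype.val (hb' k)) F (fun x => (f x).1)
        (Subtype.val_injective.comp hf) (fun k x => congrArg Subtype.val (hfe k x)) fun t => ?_
      constructor
      · intro ht
        obtain ⟨x, hx⟩ := (hfr ⟨t, by rw [ht]; exact b'.2⟩).1 (Subtype.ext ht)
        exact ⟨x, congrArg Subtype.val hx⟩
      · rintro ⟨x, rfl⟩
        exact congrArg Subtype.val ((hfr (f x)).2 ⟨x, rfl⟩)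
  classical
  refine C.iso H _ _ (Equiv.sumCompl (fun t => ∃ l : H, l • b = p t)) ?_ (hC.coprod H _ _ h1 h2)
  rintro h (t | t) <;> rfl

end Fibrations

/-! ### Admissible sets of the free operad -/

section AdmissibleSetsOfFree

open OpTerm

variable {G : Type u} [Group G] {S : GSymSeq G} (c : ∀ n, S.obj n → Perm (Fin n))
  (hc : ∀ n (τ : Perm (Fin n)) (s : S.obj n), c n (((1, τ) : G × Perm (Fin n)) • s) = τ * c n s)

/-- If an element of the free operad represents a term that is fixed by the graph of an `H`-set
`T`, then `T` belongs to the indexing system `C`. The inputs of a tree with root `s`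
map to those of `s`, with the inputs of the branches as fibres. -/
theorem IsTree.mem_of_fixed {C : CoefSystem G} (hC : C.IsIndexing) (hS : S.IsNSym)
    (hSC : S.Realizes C) (F : GOperad.Hom (freeOperad S) (termOperad G S.obj))
    (hF : ∀ n (s : S.obj n), F.app n ((freeUnit S).app n s) = (termUnit c hc).app n s)
    {n : ℕ} {x : (freeOperad S).obj n} (hx : IsTree S x) {H : Subgroup G} {T : Type u}
    [MulAction H T] (ι : Fin n ≃ T)
    (hT : ∀ (h : H) (σ : Perm (Fin n)), (∀ m, h • ι m = ι (σ m)) →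
      ((h : G), σ) • F.app n x = F.app n x) : C.mem H T := by
  induction hx generalizing H T with
  | one =>
    have := Finite.of_equiv _ ι
    have := ι.symm.injective.subsingleton
    exact C.trivial H T fun _ _ => Subsingleton.elim _ _
  | @node k j n hj σ s y hy ih =>
    have hcomp : F.app n (((1, σ) : G × Perm (Fin n)) •
        (freeOperad S).comp hj ((freeUnit S).app k s) y) = ((1, σ) : G × Perm (Fin n)) •
          (termOperad G S.obj).comp hj ((termUnit c hc).app k s) (fun i => F.app (j i) (y i)) := by
      rw [F.map_smul, F.map_comp, hF]
    -- `τ h` is the permutation of the inputs of the tree induced by `h`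
    let ι' : Fin n ≃ T := σ.trans ι
    let τ (h : H) : Perm (Fin n) := (ι'.trans (MulAction.toPerm h)).trans ι'.symm
    have hτ (h : H) (m) : h • ι' m = ι' (τ h m) := by simp [τ]
    have hfix (h : H) : ((h : G), τ h) •
        (termOperad G S.obj).comp hj ((termUnit c hc).app k s) (fun i => F.app (j i) (y i)) =
        (termOperad G S.obj).comp hj ((termUnit c hc).app k s) (fun i => F.app (j i) (y i)) := by
      have h1 := hT h (σ * τ h * σ⁻¹) fun m => by
        have := hτ h (σ⁻¹ m)
        simpa [ι'] using this
      rw [hcomp, ← mul_smul] at h1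
      have h2 := congrArg (((1, σ⁻¹) : G × Perm (Fin n)) • ·) h1
      simpa [← mul_smul, ← Prod.one_eq_mk] using h2
    choose β hβs hβ using fun h => exists_root_perm c hc hS hj s _ _ _ (hfix h)
    let : MulAction H (ULift.{u} (Fin k)) :=
      { smul := fun h b => ⟨β h b.down⟩
        one_smul := fun b => by
          have : β 1 = 1 := hS.perm_unique (hβs 1) (one_smul _ s)
          change ULift.up (β 1 b.down) = b
          rw [this]
          rfl
        mul_smul := fun g h b => by
          have : β (g * h) = β g * β h := hS.perm_unique (hβs (g * h)) (by
            have h1 : ((((g * h : H) : G), β g * β h) : G × Perm (Fin k)) =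
              ((g : G), β g) * ((h : G), β h) := rfl
            rw [h1, mul_smul, hβs, hβs])
          change ULift.up (β (g * h) b.down) = ULift.up (β g (β h b.down))
          rw [this]
          rfl }
    have hB : C.mem H (ULift.{u} (Fin k)) := by
      rw [← hSC, GSymSeq.admissible_iff]
      refine ⟨k, Equiv.ulift.symm, s, fun h α hα => ?_⟩
      have : α = β h := by
        ext1 i
        exact (congrArg ULift.down (hα i)).symm
      rw [this, hβs]
    -- `h` moves the inputs of the `i`-th branch to those of the branch `β h i`
    have hmove (h : H) (i : Fin k) (m : Fin (j i)) :
        ∃ m', τ h (leafEquiv hj ⟨i, m⟩) = leafEquiv hj ⟨β h i, m'⟩ := by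
      have h1 := congrArg OpTerm.vars (hβ h i 1)
      rw [vars_map, vars_map, (hy i).vars_eq_univ c hc F hF, (hy _).vars_eq_univ c hc F hF,
        Set.image_univ, Set.image_univ] at h1
      obtain ⟨m', hm'⟩ := h1.subset ⟨m, rfl⟩
      exact ⟨m', hm'.symm⟩
    refine hC.mem_of_fibres (fun t => ULift.up ((leafEquiv hj).symm (ι'.symm t)).1) (fun h t => ?_)
      hB (fun b K hK hKb E _ f hf hfe hfr => ?_)
    · obtain ⟨q, rfl⟩ := ι'.surjective t
      obtain ⟨⟨i, m⟩, rfl⟩ := (leafEquiv hj).surjective q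
      obtain ⟨m', hm'⟩ := hmove h i m
      simp only [hτ, hm', Equiv.symm_apply_apply]
      rfl
    · obtain ⟨i⟩ := b
      have hfib (m : Fin (j i)) : ∃ e, f e = ι' (leafEquiv hj ⟨i, m⟩) :=
        (hfr _).1 (by simp)
      choose κ hκ using hfib
      have hκb : Function.Bijective κ := by
        constructor
        · intro m m' hm
          have h1 := (hκ m).symm.trans ((congrArg f hm).trans (hκ m'))
          simpa using h1
        · intro e
          have h1 := (hfr (f e)).2 ⟨e, rfl⟩
          obtain ⟨⟨i', m⟩, hm⟩ := ((leafEquiv hj).trans ι').surjective (f e)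
          rw [← hm] at h1
          obtain rfl : i' = i := by simpa using h1
          exact ⟨m, hf ((hκ m).trans hm)⟩
      refine ih i (Equiv.ofBijective κ hκb) fun l α hα => funext fun x => ?_
      have hβi : β (Subgroup.inclusion hK l) i = i := congrArg ULift.down (hKb l)
      have h1 := hβ (Subgroup.inclusion hK l) i x
      rw [hβi] at h1
      have h2 (m) : τ (Subgroup.inclusion hK l) (leafEquiv hj ⟨i, m⟩) = leafEquiv hj ⟨i, α m⟩ := by
        apply ι'.injective
        rw [← hτ, ← hκ, ← hκ, ← hfe]
        exact congrArg f (hα m)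
      simp only [h2] at h1
      have h3 := (map_map α (fun m => leafEquiv hj ⟨i, m⟩) _).trans h1
      refine (termSymSeq_smul _ _ x).trans (map_injective (fun m m' hm => ?_) h3)
      simpa using hm

theorem freeOperad_realizes {C : CoefSystem G} (hC : C.IsIndexing) (hS : S.IsNSym)
    (hSC : S.Realizes C) : (freeOperad S).Realizes C := by
  choose c hc using hS.exists_labelling
  obtain ⟨F, hF⟩ := exists_termHom c hc
  intro H T _
  constructor
  · rw [GSymSeq.admissible_iff]
    rintro ⟨n, ι, x, hx⟩
    exact (isTree x).mem_of_fixed c hc hC hS hSC F hF ι fun h σ hσ => by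
      rw [← F.map_smul, hx h σ hσ]
  · rw [← hSC, GSymSeq.admissible_iff, GSymSeq.admissible_iff]
    rintro ⟨n, ι, s, hs⟩
    exact ⟨n, ι, (freeUnit S).app n s, fun h σ hσ => by
      rw [← (freeUnit S).map_smul, hs h σ hσ]⟩

end AdmissibleSetsOfFree

/-! ### A symmetric sequence with prescribed admissible sets -/

section Generators

variable {G : Type u} [Group G]

/-- The action of `H` on `n` points through `α`. -/
abbrev homAction {H : Subgroup G} {n : ℕ} (α : H →* Perm (Fin n)) :
    MulAction H (ULift.{u} (Fin n)) where
  smul h b := ⟨α h b.down⟩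
  one_smul b := by
    change ULift.up (α 1 b.down) = b
    rw [map_one]
    rfl
  mul_smul g h b := by
    change ULift.up (α (g * h) b.down) = ULift.up (α g (α h b.down))
    rw [map_mul]
    rfl

/-- The actions of subgroups of `G` on `n` points that belong to `C`. -/
structure CoefSystem.Rep (C : CoefSystem G) (n : ℕ) : Type u where
  /-- The subgroup that acts. -/
  grp : Subgroup G
  /-- The permutation representation. -/
  hom : grp →* Perm (Fin n)
  mem : @CoefSystem.mem _ _ C grp (ULift.{u} (Fin n)) (homAction hom)

/-- The symmetric sequence with an orbit `(G × Σₙ) / Γ` for the graph `Γ` of every action on `n`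
points that belongs to `C`. -/
def CoefSystem.symSeq (C : CoefSystem G) : GSymSeq G where
  obj n := Σ D : C.Rep n, (G × Perm (Fin n)) ⧸ graphSubgroup D.grp D.hom
  action _ := inferInstance

theorem mem_graphSubgroup {H : Subgroup G} {n : ℕ} {α : H →* Perm (Fin n)} {g : G}
    {σ : Perm (Fin n)} : (g, σ) ∈ graphSubgroup H α ↔ ∃ h : H, (h : G) = g ∧ α h = σ := by
  simp [graphSubgroup, MonoidHom.mem_range, Prod.ext_iff]

theorem CoefSystem.symSeq_smul_eq_iff {C : CoefSystem G} {n : ℕ} (D : C.Rep n)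
    (a b : G × Perm (Fin n)) :
    a • (⟨D, (b : _ ⧸ graphSubgroup D.grp D.hom)⟩ : C.symSeq.obj n) = ⟨D, b⟩ ↔
      b⁻¹ * a * b ∈ graphSubgroup D.grp D.hom := by
  have h1 : a • (⟨D, (b : _ ⧸ graphSubgroup D.grp D.hom)⟩ : C.symSeq.obj n) =
    (⟨D, ((a * b : G × Perm (Fin n)) : _ ⧸ graphSubgroup D.grp D.hom)⟩ : C.symSeq.obj n) := rfl
  rw [h1, eq_comm, Sigma.mk.injEq, heq_eq_eq, and_iff_right rfl, QuotientGroup.eq, mul_assoc]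

theorem CoefSystem.symSeq_isNSym (C : CoefSystem G) : C.symSeq.IsNSym where
  free n σ x hx := by
    obtain ⟨D, b⟩ := x
    obtain ⟨⟨a, τ⟩, rfl⟩ := QuotientGroup.mk_surjective b
    have h1 := (symSeq_smul_eq_iff D _ _).1 hx
    simp only [Prod.inv_mk, Prod.mk_mul_mk, mul_one, inv_mul_cancel] at h1
    obtain ⟨h, hh, hσ⟩ := mem_graphSubgroup.1 h1
    obtain rfl : h = 1 := Subtype.ext hh
    rw [map_one, eq_comm, mul_assoc, inv_mul_eq_one] at hσ
    exact right_eq_mul.1 hσ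
  fixed n H := by
    let D : C.Rep n := ⟨H, 1, by
      let := homAction (1 : H →* Perm (Fin n))
      exact C.trivial _ _ fun _ _ => rfl⟩
    refine ⟨⟨D, ((1 : G × Perm (Fin n)) : _ ⧸ graphSubgroup D.grp D.hom)⟩, ?_⟩
    rintro ⟨⟨g, σ⟩, hg, hσ⟩
    refine (symSeq_smul_eq_iff D (g, σ) 1).2 ?_
    rw [inv_one, one_mul, mul_one]
    exact mem_graphSubgroup.2 ⟨⟨g, hg⟩, rfl, (Subgroup.mem_bot.1 hσ).symm⟩

theorem CoefSystem.symSeq_realizes (C : CoefSystem G) : C.symSeq.Realizes C := by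
  intro H T _
  rw [GSymSeq.admissible_iff]
  constructor
  · rintro ⟨n, ι, ⟨D, b⟩, hx⟩
    obtain ⟨⟨a, τ⟩, rfl⟩ := QuotientGroup.mk_surjective b
    have key (h : H) : ∃ d : D.grp, (d : G) = a⁻¹ * h * a ∧
        ∀ m, h • ι (τ m) = ι (τ (D.hom d m)) := by
      let σ : Perm (Fin n) := (ι.trans (MulAction.toPerm h)).trans ι.symm
      have hσ (m) : h • ι m = ι (σ m) := by simp [σ]
      have h1 := (symSeq_smul_eq_iff D _ _).1 (hx h σ hσ)
      simp only [Prod.inv_mk, Prod.mk_mul_mk] at h1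
      obtain ⟨d, hd, hdσ⟩ := mem_graphSubgroup.1 h1
      exact ⟨d, hd, fun m => by rw [hσ, hdσ]; simp⟩
    let := homAction D.hom
    have hle : H ≤ conjSubgroup a D.grp := fun h hh => by
      obtain ⟨d, hd, -⟩ := key ⟨h, hh⟩
      exact ⟨d, d.2, by simp [hd, mul_assoc]⟩
    have h1 := @CoefSystem.res _ _ C H _ hle _ (conjAction a _) (C.conj D.grp a _ D.mem)
    let := conjAction a (ULift.{u} (Fin n)) (H := D.grp)
    let := resAction hle (ULift.{u} (Fin n))
    refine C.iso H _ T (Equiv.ulift.trans (τ.trans ι)) (fun h m => ?_) h1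
    obtain ⟨d, hd, hdm⟩ := key h
    have : conjHom a D.grp (Subgroup.inclusion hle h) = d := Subtype.ext hd.symm
    change ι (τ (D.hom (conjHom a D.grp (Subgroup.inclusion hle h)) m.down)) = h • ι (τ m.down)
    rw [this, hdm]
  · intro hT
    have := C.finite H T hT
    obtain ⟨n, ⟨e⟩⟩ := Finite.exists_equiv_fin T
    let α : H →* Perm (Fin n) := e.permCongrHom.toMonoidHom.comp (MulAction.toPermHom H T)
    let := homAction α
    let D : C.Rep n := ⟨H, α, C.iso H T _ (e.trans Equiv.ulift.symm) (fun h t => by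
      change ULift.up (e (h • t)) = ULift.up (e (h • e.symm (e t)))
      rw [Equiv.symm_apply_apply]) hT⟩
    refine ⟨n, e.symm, ⟨D, ((1 : G × Perm (Fin n)) : _ ⧸ graphSubgroup D.grp D.hom)⟩,
      fun h σ hσ => (symSeq_smul_eq_iff D (_, σ) 1).2 ?_⟩
    rw [inv_one, one_mul, mul_one]
    refine mem_graphSubgroup.2 ⟨h, rfl, Equiv.ext fun m => ?_⟩
    change e (h • e.symm m) = σ m
    rw [hσ, Equiv.apply_symm_apply]

end Generators

theorem theorem3p2 (G : Type u) [Group G] [Finite G] :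
    (∀ (C : CoefSystem G) (S : GSymSeq G), S.IsNSym → S.Realizes C →
      (freeOperad S).IsNSym ∧
      List.TFAE
        [C.RealizedInGCat,
         C.RealizedInGTop,
         C.RealizedInGCGWH,
         C.RealizedInNOp,
         (freeOperad S).Realizes C,
         C.IsIndexing] ∧
      (C.IsIndexing →
        (chaoticOperad (freeOperad S)).IsNInfty ∧ (chaoticOperad (freeOperad S)).ob.Realizes C)) ∧
    (∀ C : CoefSystem G, C.IsIndexing →
      C.RealizedInGCat ∧ C.RealizedInGTop ∧ C.RealizedInGCGWH) := by
  have main (C : CoefSystem G) (S : GSymSeq G) (hS : S.IsNSym) (hSC : S.Realizes C) :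
      (freeOperad S).IsNSym ∧
      List.TFAE
        [C.RealizedInGCat,
         C.RealizedInGTop,
         C.RealizedInGCGWH,
         C.RealizedInNOp,
         (freeOperad S).Realizes C,
         C.IsIndexing] ∧
      (C.IsIndexing → (chaoticOperad (freeOperad S)).IsNInfty ∧
        (chaoticOperad (freeOperad S)).ob.Realizes C) := by
    have hfree := freeOperad_isNSym hS
    refine ⟨hfree, ?_, fun hC =>
      ⟨chaoticOperad_isNInfty _ hfree, freeOperad_realizes hC hS hSC⟩⟩
    tfae_have 1 → 4 := fun ⟨O, hO, h⟩ => ⟨O.ob, hO.isNSym, h⟩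
    tfae_have 2 → 4 := fun ⟨O, hO, h⟩ => ⟨O.ob, hO.isNSym, h⟩
    tfae_have 3 → 4 := fun ⟨O, hO, h⟩ => ⟨O.ob, hO.isNSym, h⟩
    tfae_have 4 → 6 := isIndexing_of_realizedInNOp
    tfae_have 6 → 5 := fun hC => freeOperad_realizes hC hS hSC
    tfae_have 5 → 1 := fun h => ⟨_, chaoticOperad_isNInfty _ hfree, h⟩
    tfae_have 5 → 2 := fun h => realizedInGTop_of_realizedInNOp ⟨_, hfree, h⟩
    tfae_have 5 → 3 := fun h => realizedInGCGWH_of_realizedInNOp ⟨_, hfree, h⟩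
    tfae_finish
  refine ⟨main, fun C hC => ?_⟩
  obtain ⟨-, h, -⟩ := main C C.symSeq C.symSeq_isNSym C.symSeq_realizes
  exact ⟨(h.out 5 0).1 hC, (h.out 5 1).1 hC, (h.out 5 2).1 hC⟩
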